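/- Let $(X,\mu)$ be a nonatomic probability space and let $\mathcal T$ be a tree on it, i.e. a set of measurable subsets of $X$ such that: (i) $X\in\mathcal T$ and $\mu(I)>0$ for all $I\in\mathcal T$; (ii) to every $I\in\mathcal T$ corresponds a finite or countable set $C(I)\subseteq\mathcal T$ with at least two elements, consisting of pairwise disjoint subsets of $I$ with union $I$; (iii) $\mathcal T=\bigcup_{m\ge 0}\mathcal T_{(m)}$, where $\mathcal T_{(0)}=\{X\}$ and $\mathcal T_{(m+1)}=\bigcup_{I\in\mathcal T_{(m)}}C(I)$; (iv) $\lim_{m\to\infty}\sup_{I\in\mathcal T_{(m)}}\mu(I)=0$; (v) $\mathcal T$ differentiates $L^1(X,\mu)$: for every $\varphi\in L^1(X,\mu)$ and $\mu$-almost every $x$, $\frac1{\mu(I)}\int_I\varphi\,d\mu\to\varphi(x)$ as $\mu(I)\to0$ with $x\in I\in\mathcal T$. Let $M_{\mathcal T}\varphi(x)=\sup\{\frac1{\mu(I)}\int_I|\varphi|\,d\mu : x\in I\in\mathcal T\}$. For $p>1$, $0<f^p\le F$ with $f>0$, $L\ge f$ and $k\in(0,1]$ let $$B_p^{\mathcal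 T}(f,F,L,k)=\sup\Big\{\int_K\max(M_{\mathcal T}\varphi,L)^p\,d\mu:\ \varphi\ge0,\ \int_X\varphi\,d\mu=f,\ \int_X\varphi^p\,d\mu=F,\ K\subseteq X\text{ measurable},\ \mu(K)=k\Big\},$$ and let $B_p^{\mathcal T}(f,F,k)=B_p^{\mathcal T}(f,F,f,k)$ (so that the integrand is $(M_{\mathcal T}\varphi)^p$). Let $\omega_p:[0,1]\to[1,\frac p{p-1}]$ be the inverse of the function $H_p(z)=-(p-1)z^p+pz^{p-1}$ on $[1,\frac p{p-1}]$, and let $h_k(B)=\frac{(f-B)^p}{(1-k)^{p-1}}+\frac{B^p}{k^{p-1}}$ for $B\in[0,f]$. **Theorem 1.1.** For all $p>1$, $f>0$, $F\ge f^p$ and $k\in(0,1]$, the number $B_p^{\mathcal T}(f,F,k)$ is finite and $$B_p^{\mathcal T}(f,F,k)=\sup\left\{\Big(F-\tfrac{(f-B)^p}{(1-k)^{p-1}}\Big)\,\omega_p\!\left(\frac{B^p}{k^{p-1}\Big(F-\frac{(f-B)^p}{(1-k)^{p-1}}\Big)}\right)^{p}:\ B\in[0,f],\ h_k(B)\le F\right\}.$$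 Conventions: if $F-\frac{(f-B)^p}{(1-k)^{p-1}}=0$ (which for admissible $B$ is possible only at $B=0$), the expression in the supremum is $0$; for $k=1$ the term $\frac{(f-B)^p}{(1-k)^{p-1}}$ is $0$ if $B=f$ and $+\infty$ if $B<f$, so that only $B=f$ is admissible and the formula reads $B_p^{\mathcal T}(f,F,1)=F\,\omega_p(f^p/F)^p$. -/

import Mathlib

open MeasureTheory Filter Topology Set
open scoped ENNReal

noncomputable section

namespace TreeBellman

variable {X : Type*} [MeasurableSpace X]

/-- A measure is nonatomic if every measurable set of positive measure has a measurable subset of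
strictly smaller positive measure. (For probability spaces this is stronger than Mathlib's
`NoAtoms`, which speaks about singletons only.) -/
def Nonatomic (μ : Measure X) : Prop :=
  ∀ A : Set X, MeasurableSet A → 0 < μ A → ∃ B ⊆ A, MeasurableSet B ∧ 0 < μ B ∧ μ B < μ A

/-- The generations `T₍₀₎ = {X}`, `T₍ₘ₊₁₎ = ⋃_{I ∈ T₍ₘ₎} C(I)` determined by the children map `C`. -/
def level (C : Set X → Set (Set X)) : ℕ → Set (Set X)
  | 0 => {univ}
  | m + 1 => ⋃ I ∈ level C m, C I

/-- `T` is a tree on the measure space `(X, μ)`. -/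
structure IsTree (μ : Measure X) (T : Set (Set X)) : Prop where
  measurableSet : ∀ I ∈ T, MeasurableSet I
  univ_mem : univ ∈ T
  measure_pos : ∀ I ∈ T, 0 < μ I
  /-- There are at most countable families `C(I)` of at least two children, partitioning `I`, whose
  generations exhaust `T` and have measures tending uniformly to `0`. -/
  exists_children : ∃ C : Set X → Set (Set X),
    (∀ I ∈ T, C I ⊆ T ∧ (C I).Countable ∧ (C I).Nontrivial ∧
      (C I).PairwiseDisjoint id ∧ I = ⋃₀ C I) ∧
    T = ⋃ m, level C m ∧
    Tendsto (fun m => ⨆ I ∈ level C m, μ I) atTop (𝓝 0)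
  /-- `T` differentiates `L¹(X, μ)`: for almost every `x`, the averages of `φ` over `I ∈ T` with
  `x ∈ I` tend to `φ x` as `μ I → 0`. -/
  differentiates : ∀ φ : X → ℝ, Integrable φ μ → ∀ᵐ x ∂μ,
    Tendsto (fun I : Set X => ⨍ y in I, φ y ∂μ)
      (comap (fun I : Set X => μ I) (𝓝 0) ⊓ 𝓟 {I | I ∈ T ∧ x ∈ I}) (𝓝 (φ x))

/-- The maximal operator of `T`: `M_T φ (x) = sup { μ(I)⁻¹ ∫_I |φ| dμ : x ∈ I ∈ T }`. -/
def maximal (μ : Measure X) (T : Set (Set X)) (φ : X → ℝ) (x : X) : ℝ≥0∞ :=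
  ⨆ I ∈ T, ⨆ _ : x ∈ I, (∫⁻ y in I, ‖φ y‖ₑ ∂μ) / μ I

/-- The Bellman function of four variables
`B_p^T(f, F, L, k) = sup { ∫_K max(M_T φ, L)^p dμ : φ ≥ 0, ∫ φ = f, ∫ φ^p = F, μ(K) = k }`. -/
def bellman₄ (μ : Measure X) (T : Set (Set X)) (p f F L k : ℝ) : ℝ≥0∞ :=
  sSup {v | ∃ (φ : X → ℝ) (K : Set X),
    (∀ x, 0 ≤ φ x) ∧ MemLp φ (ENNReal.ofReal p) μ ∧
    ∫ x, φ x ∂μ = f ∧ ∫ x, φ x ^ p ∂μ = F ∧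
    MeasurableSet K ∧ μ K = ENNReal.ofReal k ∧
    v = ∫⁻ x in K, max (maximal μ T φ x) (ENNReal.ofReal L) ^ p ∂μ}

/-- The Bellman function of the dyadic Carleson imbedding theorem,
`B_p^T(f, F, k) = B_p^T(f, F, f, k)`. -/
def bellman (μ : Measure X) (T : Set (Set X)) (p f F k : ℝ) : ℝ≥0∞ :=
  bellman₄ μ T p f F f k

/-- `H_p(z) = -(p - 1) z^p + p z^(p-1)`. -/
def H (p z : ℝ) : ℝ := -(p - 1) * z ^ p + p * z ^ (p - 1)

/-- For `p > 1`, `H_p` is a bijection of `[1, p/(p-1)]` onto `[0, 1]`. -/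
theorem bijOn_H {p : ℝ} (hp : 1 < p) : BijOn (H p) (Icc 1 (p / (p - 1))) (Icc 0 1) := by
  have hp1 : 0 < p - 1 := by linarith
  have hle : 1 ≤ p / (p - 1) := by rw [le_div_iff₀ hp1]; linarith
  have hc : ContinuousOn (H p) (Icc 1 (p / (p - 1))) := by
    refine ContinuousOn.add (continuousOn_const.mul ?_) (continuousOn_const.mul ?_) <;>
      exact continuousOn_id.rpow_const (fun x hx => Or.inl (by
        have := hx.1; simp only [id]; linarith))
  have h1 : H p 1 = 1 := by simp [H]
  have h0 : H p (p / (p - 1)) = 0 := by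
    have hz : 0 < p / (p - 1) := by linarith
    have : (p / (p - 1)) ^ p = (p / (p - 1)) ^ (p - 1) * (p / (p - 1)) := by
      rw [← Real.rpow_add_one hz.ne']; congr 1; ring
    rw [H, this]; field_simp; ring
  have hanti : StrictAntiOn (H p) (Icc 1 (p / (p - 1))) := by
    refine strictAntiOn_of_deriv_neg (convex_Icc _ _) hc fun x hx => ?_
    rw [interior_Icc] at hx
    have hx1 := hx.1
    have hx0 : 0 < x := by linarith
    have hd : HasDerivAt (H p) (-(p - 1) * (p * x ^ (p - 1)) +
        p * ((p - 1) * x ^ (p - 1 - 1))) x :=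
      ((Real.hasDerivAt_rpow_const (Or.inl hx0.ne')).const_mul _).add
        ((Real.hasDerivAt_rpow_const (Or.inl hx0.ne')).const_mul _)
    rw [hd.deriv]
    have hlt : x ^ (p - 1 - 1) < x ^ (p - 1) := Real.rpow_lt_rpow_of_exponent_lt hx1 (by linarith)
    have : 0 < p * (p - 1) * (x ^ (p - 1) - x ^ (p - 1 - 1)) :=
      mul_pos (mul_pos (by linarith) hp1) (by linarith)
    linarith
  refine ⟨fun x hx => ⟨?_, ?_⟩, hanti.injOn, ?_⟩
  · rw [← h0]; exact hanti.antitoneOn hx (right_mem_Icc.2 hle) hx.2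
  · rw [← h1]; exact hanti.antitoneOn (left_mem_Icc.2 hle) hx hx.1
  · have := intermediate_value_Icc' hle hc
    rwa [h1, h0] at this

/-- `ω_p : [0, 1] → [1, p/(p-1)]`, the inverse function of `H_p : [1, p/(p-1)] → [0, 1]`. -/
def omega (p θ : ℝ) : ℝ := Function.invFunOn (H p) (Icc 1 (p / (p - 1))) θ

/-- `h_k(B) = (f - B)^p / (1 - k)^(p-1) + B^p / k^(p-1)`. -/
def hfun (p f k B : ℝ) : ℝ := (f - B) ^ p / (1 - k) ^ (p - 1) + B ^ p / k ^ (p - 1)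

/-- The points `B ∈ [0, f]` with `h_k(B) ≤ F`. For `k = 1` the quotient `(f - B)^p / 0` is read as
`+∞` if `B < f` and as `0` if `B = f`, so that only `B = f` can be admissible; for `k < 1` the last
condition is void. -/
def admissible (p f F k : ℝ) : Set ℝ :=
  {B | B ∈ Icc 0 f ∧ hfun p f k B ≤ F ∧ (k = 1 → B = f)}

/-- `A_k(B) = F - (f - B)^p / (1 - k)^(p-1)`. -/
def Afun (p f F k B : ℝ) : ℝ := F - (f - B) ^ p / (1 - k) ^ (p - 1)

/-- `R_k(B) = A_k(B) ω_p(B^p / (k^(p-1) A_k(B)))^p`. If `A_k(B) = 0`, this is `0`. -/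
def Rfun (p f F k B : ℝ) : ℝ :=
  Afun p f F k B * omega p (B ^ p / (k ^ (p - 1) * Afun p f F k B)) ^ p

end TreeBellman

end

/-! Write $A = A_k(B)$ and $\theta = B^p/(k^{p-1}A)$. Upper bound. For a competitor $\varphi, K$
there is a set $D$ of measure $k$ that contains $\{M_{\mathcal T}\varphi > b\}$, where $B =
\int_D\varphi$ and $b = B/k$ (`IsTree.exists_top_set`). Put $v = \max(b, \min(M_{\mathcal T}\varphi,
N))$. The excess $v^p - b^p$ is nonnegative and lives on $D$, so $\int_K v^p \le \int_D v^p$.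
Superlevel sets of $M_{\mathcal T}\varphi$ are disjoint unions of tree elements with large averages;
integrating the resulting weak type inequality over the levels above $b$ (`integral_rpow_sub_le`)
gives $(p-1)\int_D v^p + kb^p \le p\int_D\varphi v^{p-1}$. Jensen on $D^c$ gives $\int_D\varphi^p
\le A$, and Hölder's inequality then yields $\theta \le H_p(\sigma)$ for $\sigma^p = \int_D v^p/A$.
Since $H_p$ decreases on $[1,\infty)$, $\sigma \le \omega_p(\theta)$ (`IsTree.moment_inequality`);
let $N \to \infty$.

Lower bound. Every tree element contains disjoint tree elements of any prescribed smaller total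
measure (`IsChildMap.exists_family`). Iterating gives unions $E_0 \supseteq E_1 \supseteq \cdots$
with $\mu(E_0) = k$, such that $E_{n+1}$ fills the proportion $1-a$ of each element composing $E_n$.
Let $\varphi = c\rho^n$ on $E_n \setminus E_{n+1}$ and constant off $E_0$. The averages over the
elements of $E_n$ are $w c\rho^n$, so $M_{\mathcal T}\varphi \ge w\varphi$ a.e. on $E_0$ and the
Bellman function is at least $A w^p$. The moment conditions leave one equation between $a$ and $w$;
to first order in $a$ it reads $H_p(w) = \theta$, so $w$ can be pushed up to $\omega_p(\theta)$
(`exists_ratio`). -/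

namespace TreeBellman

variable {X : Type*} [MeasurableSpace X]

/-! ### Combinatorics of trees and intermediate values of measures -/

/-- `C` assigns to every element of the tree `T` its children. -/
structure IsChildMap (μ : Measure X) (T : Set (Set X)) (C : Set X → Set (Set X)) : Prop where
  subset : ∀ I ∈ T, C I ⊆ T
  countable : ∀ I ∈ T, (C I).Countable
  nonempty : ∀ I ∈ T, (C I).Nonempty
  disjoint : ∀ I ∈ T, (C I).PairwiseDisjoint id
  sUnion_eq : ∀ I ∈ T, ⋃₀ C I = I
  eq_iUnion : T = ⋃ m, level C m
  tendsto : Tendsto (fun m => ⨆ I ∈ level C m, μ I) atTop (𝓝 0)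

theorem IsTree.exists_isChildMap {μ : Measure X} {T : Set (Set X)} (hT : IsTree μ T) :
    ∃ C, IsChildMap μ T C := by
  obtain ⟨C, hC, h1, h2⟩ := hT.exists_children
  exact ⟨C, fun I hI => (hC I hI).1, fun I hI => (hC I hI).2.1,
    fun I hI => (hC I hI).2.2.1.nonempty, fun I hI => (hC I hI).2.2.2.1,
    fun I hI => (hC I hI).2.2.2.2.symm, h1, h2⟩

namespace IsChildMap

variable {μ : Measure X} {T : Set (Set X)} {C : Set X → Set (Set X)}

theorem level_subset (h : IsChildMap μ T C) (m : ℕ) : level C m ⊆ T := by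
  rw [h.eq_iUnion]; exact subset_iUnion (level C) m

theorem exists_mem_level (h : IsChildMap μ T C) {I : Set X} (hI : I ∈ T) : ∃ m, I ∈ level C m := by
  rw [h.eq_iUnion] at hI; exact mem_iUnion.1 hI

theorem subset_of_mem (h : IsChildMap μ T C) {I J : Set X} (hI : I ∈ T) (hJ : J ∈ C I) : J ⊆ I := by
  rw [← h.sUnion_eq I hI]; exact subset_sUnion_of_mem hJ

theorem level_countable (h : IsChildMap μ T C) (m : ℕ) : (level C m).Countable := by
  induction m with
  | zero => exact countable_singleton _
  | succ m ih => exact ih.biUnion fun I hI => h.countable I (h.level_subset m hI)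

theorem countable_tree (h : IsChildMap μ T C) : T.Countable := by
  rw [h.eq_iUnion]; exact countable_iUnion h.level_countable

theorem level_disjoint (h : IsChildMap μ T C) (m : ℕ) : (level C m).PairwiseDisjoint id := by
  induction m with
  | zero => exact pairwiseDisjoint_singleton _ _
  | succ m ih =>
    intro I hI J hJ hne
    obtain ⟨I', hI', hI⟩ := mem_iUnion₂.1 hI
    obtain ⟨J', hJ', hJ⟩ := mem_iUnion₂.1 hJ
    by_cases he : I' = J'
    · subst he
      exact h.disjoint I' (h.level_subset m hI') hI hJ hne
    · exact (ih hI' hJ' he).mono (h.subset_of_mem (h.level_subset m hI') hI)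
        (h.subset_of_mem (h.level_subset m hJ') hJ)

theorem exists_superset (h : IsChildMap μ T C) {I : Set X} {n m : ℕ} (hnm : n ≤ m)
    (hI : I ∈ level C m) : ∃ J ∈ level C n, I ⊆ J := by
  induction m, hnm using Nat.le_induction generalizing I with
  | base => exact ⟨I, hI, Subset.rfl⟩
  | succ m _ ih =>
    obtain ⟨I', hI', hI⟩ := mem_iUnion₂.1 hI
    obtain ⟨J, hJ, hs⟩ := ih hI'
    exact ⟨J, hJ, (h.subset_of_mem (h.level_subset m hI') hI).trans hs⟩

/-- Tree elements behave like dyadic intervals: any two are nested or disjoint, and the level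
decides the direction of the inclusion. -/
theorem subset_of_not_disjoint (h : IsChildMap μ T C) {I J : Set X} {n m : ℕ} (hnm : n ≤ m)
    (hI : I ∈ level C m) (hJ : J ∈ level C n) (hd : ¬Disjoint I J) : I ⊆ J := by
  obtain ⟨J', hJ', hs⟩ := h.exists_superset hnm hI
  by_cases he : J' = J
  · exact he ▸ hs
  · exact absurd ((h.level_disjoint n hJ' hJ he).mono_left hs) hd

/-- Every subfamily of the tree is dominated by a disjoint family of its elements. -/
theorem exists_disjoint_subfamily (h : IsChildMap μ T C) {S : Set (Set X)} (hS : S ⊆ T) :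
    ∃ D ⊆ S, D.PairwiseDisjoint id ∧ ⋃₀ D = ⋃₀ S := by
  -- The maximal elements of `S`. A member containing a given point at the least possible level is
  -- maximal, so the union is not lost.
  refine ⟨{I | I ∈ S ∧ ∀ J ∈ S, I ⊆ J → J = I}, fun I hI => hI.1, ?_, ?_⟩
  · intro I hI J hJ hne
    by_contra hd
    obtain ⟨m, hm⟩ := h.exists_mem_level (hS hI.1)
    obtain ⟨n, hn⟩ := h.exists_mem_level (hS hJ.1)
    rcases le_total n m with hnm | hnm
    · exact hne (hI.2 J hJ.1 (h.subset_of_not_disjoint hnm hm hn hd)).symm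
    · exact hne (hJ.2 I hI.1 (h.subset_of_not_disjoint hnm hn hm fun h' => hd h'.symm))
  · refine Subset.antisymm (sUnion_subset_sUnion fun I hI => hI.1) ?_
    rintro x ⟨I, hI, hx⟩
    have hex : ∃ n, ∃ J ∈ S, J ∈ level C n ∧ x ∈ J := by
      obtain ⟨m, hm⟩ := h.exists_mem_level (hS hI)
      exact ⟨m, I, hI, hm, hx⟩
    classical
    obtain ⟨J, hJ, hJn, hxJ⟩ := Nat.find_spec hex
    refine ⟨J, ⟨hJ, fun J' hJ' hs => ?_⟩, hxJ⟩
    obtain ⟨n', hn'⟩ := h.exists_mem_level (hS hJ')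
    refine Subset.antisymm (h.subset_of_not_disjoint
      (Nat.find_min' hex ⟨J', hJ', hn', hs hxJ⟩) hn' hJn ?_) hs
    exact not_disjoint_iff.2 ⟨x, hs hxJ, hxJ⟩

/-- An initial segment of the children of `J` has measure at most `c`, and exceeds `c` together
with the next child. -/
theorem exists_initial_children (h : IsChildMap μ T C) {ν : Measure X} {J : Set X} (hJ : J ∈ T)
    {c : ℝ≥0∞} (hc : c < ν J) :
    ∃ S ⊆ C J, ∃ J' ∈ C J, J' ∉ S ∧ ν (⋃₀ S) ≤ c ∧ c < ν (⋃₀ S) + ν J' := by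
  obtain ⟨e, he⟩ := (h.countable J hJ).exists_eq_range (h.nonempty J hJ)
  have hmem : ∀ i, e i ∈ C J := fun i => he ▸ mem_range_self i
  set V : ℕ → Set X := fun n => ⋃₀ (e '' {i | i < n}) with hV
  have hmono : Monotone V := fun m n hmn =>
    sUnion_subset_sUnion (image_mono fun i (hi : i < m) => hi.trans_le hmn)
  have hun : ⋃ n, V n = J := by
    rw [← h.sUnion_eq J hJ, he]
    refine Subset.antisymm (iUnion_subset fun n =>
      sUnion_subset_sUnion (image_subset_range _ _)) ?_
    rintro x ⟨_, ⟨i, rfl⟩, hx⟩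
    exact mem_iUnion.2 ⟨i + 1, e i, mem_image_of_mem e (Nat.lt_succ_self i), hx⟩
  have hex : ∃ n, c < ν (V n) := by
    by_contra! hle
    rw [← hun, hmono.measure_iUnion] at hc
    exact absurd (iSup_le hle) (not_le.2 hc)
  classical
  -- The enumeration `e` may repeat children. The measure jumps strictly at the first index
  -- exceeding `c`, which shows that `e n` is not among its predecessors.
  obtain ⟨n, hn⟩ : ∃ n, Nat.find hex = n + 1 := by
    refine Nat.exists_eq_succ_of_ne_zero fun h0 => ?_
    have := Nat.find_spec hex
    rw [h0] at this
    simp [hV] at this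
  have hlt : c < ν (V (n + 1)) := hn ▸ Nat.find_spec hex
  have hle : ν (V n) ≤ c := not_lt.1 (Nat.find_min hex (by omega))
  have hsucc : V (n + 1) = V n ∪ e n := by
    have : {i | i < n + 1} = insert n {i | i < n} := by ext i; simp; omega
    simp only [hV, this, image_insert_eq, sUnion_insert]
    exact union_comm _ _
  refine ⟨e '' {i | i < n}, ?_, e n, hmem n, fun hin => ?_, hle, ?_⟩
  · rintro _ ⟨i, -, rfl⟩; exact hmem i
  · rw [hsucc, union_eq_self_of_subset_right (subset_sUnion_of_mem hin)] at hlt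
    exact absurd hle (not_le.2 hlt)
  · exact (hsucc ▸ hlt).trans_le (measure_union_le _ _)

/-- A measure dominated by `μ` takes every intermediate value on disjoint unions of elements of the
tree. -/
theorem exists_family (h : IsChildMap μ T C) (hT : ∀ I ∈ T, MeasurableSet I)
    {ν : Measure X} [IsFiniteMeasure ν] (hν : ν ≤ μ) {J : Set X} (hJ : J ∈ T)
    {c : ℝ≥0∞} (hc : c ≤ ν J) :
    ∃ S ⊆ T, S.PairwiseDisjoint id ∧ ⋃₀ S ⊆ J ∧ ν (⋃₀ S) = c := by
  rcases hc.eq_or_lt with rfl | hc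
  · exact ⟨{J}, by simpa using hJ, pairwiseDisjoint_singleton _ _, by simp, by simp⟩
  obtain ⟨m, hm⟩ := h.exists_mem_level hJ
  -- A state is a level, a tree element there, and the measure still to be collected inside it. One
  -- step collects whole children as long as they fit and passes the remainder to the next child.
  let Q := {q : ℕ × Set X × ℝ≥0∞ // q.2.1 ∈ level C q.1 ∧ q.2.2 < ν q.2.1}
  have step : ∀ q : Q, ∃ (S : Set (Set X)) (q' : Q), q'.1.1 = q.1.1 + 1 ∧ S ⊆ C q.1.2.1 ∧
      q'.1.2.1 ∈ C q.1.2.1 ∧ q'.1.2.1 ∉ S ∧ ν (⋃₀ S) + q'.1.2.2 = q.1.2.2 := by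
    rintro ⟨⟨n, I, d⟩, hI, hd⟩
    obtain ⟨S, hS, J', hJ', hn, h1, h2⟩ :=
      h.exists_initial_children (ν := ν) (h.level_subset n hI) hd
    exact ⟨S, ⟨⟨n + 1, J', d - ν (⋃₀ S)⟩, mem_iUnion₂.2 ⟨I, hI, hJ'⟩,
      ENNReal.sub_lt_of_lt_add h1 (by rwa [add_comm])⟩, rfl, hS, hJ', hn,
      add_tsub_cancel_of_le h1⟩
  choose S next h1 h2 h3 h4 h5 using step
  let q : ℕ → Q := fun n => next^[n] ⟨⟨m, J, c⟩, hm, hc⟩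
  have hq : ∀ n, q (n + 1) = next (q n) := fun n => Function.iterate_succ_apply' _ _ _
  have hlev : ∀ n, (q n).1.1 = m + n := by
    intro n
    induction n with
    | zero => rfl
    | succ n ih => rw [hq, h1, ih]; rfl
  have hqT : ∀ n, (q n).1.2.1 ∈ T := fun n => h.level_subset _ (q n).2.1
  have hanti : Antitone fun n => (q n).1.2.1 := antitone_nat_of_succ_le fun n => by
    rw [hq]; exact h.subset_of_mem (hqT n) (h3 _)
  have hST : ∀ n, S (q n) ⊆ T := fun n => (h2 _).trans (h.subset _ (hqT n))
  have hsub : ∀ n, ∀ I ∈ S (q n), I ⊆ (q n).1.2.1 := fun n I hI =>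
    h.subset_of_mem (hqT n) (h2 _ hI)
  have hdis : ∀ n, ∀ I ∈ S (q n), Disjoint I (q (n + 1)).1.2.1 := fun n I hI => by
    rw [hq]
    exact h.disjoint _ (hqT n) (h2 _ hI) (h3 _) fun he => h4 (q n) (he ▸ hI)
  have hlt : ∀ i j, i < j → ∀ I ∈ S (q i), ∀ I' ∈ S (q j), Disjoint I I' :=
    fun i j hij I hI I' hI' => (hdis i I hI).mono_right ((hsub j I' hI').trans (hanti hij))
  refine ⟨⋃ n, S (q n), iUnion_subset hST, ?_, ?_, ?_⟩
  · intro I hI I' hI' hne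
    obtain ⟨i, hi⟩ := mem_iUnion.1 hI
    obtain ⟨j, hj⟩ := mem_iUnion.1 hI'
    rcases lt_trichotomy i j with hij | rfl | hij
    · exact hlt i j hij I hi I' hj
    · exact h.disjoint _ (hqT i) (h2 _ hi) (h2 _ hj) hne
    · exact (hlt j i hij I' hj I hi).symm
  · rw [sUnion_iUnion]
    exact iUnion_subset fun n => sUnion_subset fun I hI => (hsub n I hI).trans (hanti n.zero_le)
  · have hmeas : ∀ n, MeasurableSet (⋃₀ S (q n)) := fun n =>
      .sUnion (h.countable_tree.mono (hST n)) fun I hI => hT I (hST n hI)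
    have hd : Pairwise (Function.onFun Disjoint fun n => ⋃₀ S (q n)) := by
      refine (pairwise_disjoint_on _).2 fun i j hij => ?_
      simp only [disjoint_sUnion_left, disjoint_sUnion_right]
      exact fun I hI I' hI' => hlt i j hij I' hI' I hI
    rw [sUnion_iUnion, measure_iUnion hd hmeas]
    have hsum : ∀ N, ∑ n ∈ Finset.range N, ν (⋃₀ S (q n)) + (q N).1.2.2 = c := by
      intro N
      induction N with
      | zero => simp [q]
      | succ N ih => rw [Finset.sum_range_succ, add_assoc, hq, h5, ih]
    -- The remainder is below the measure of one element of level `m + N`, and these measures tend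
    -- to `0` uniformly.
    have hz : Tendsto (fun N => (q N).1.2.2) atTop (𝓝 0) := by
      have ht : Tendsto (fun N => ⨆ I ∈ level C (m + N), μ I) atTop (𝓝 0) :=
        h.tendsto.comp (tendsto_atTop_mono (fun N => Nat.le_add_left N m) tendsto_id)
      refine tendsto_of_tendsto_of_tendsto_of_le_of_le tendsto_const_nhds ht
        (fun _ => zero_le) fun N => ((q N).2.2.le.trans (hν _)).trans ?_
      have := (q N).2.1
      rw [hlev] at this
      exact le_iSup₂ (f := fun I (_ : I ∈ level C (m + N)) => μ I) _ this
    have := (ENNReal.tendsto_nat_tsum fun n => ν (⋃₀ S (q n))).add hz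
    simp only [hsum, add_zero] at this
    exact tendsto_nhds_unique this tendsto_const_nhds

end IsChildMap

/-- On a space carrying a tree every measurable set has measurable subsets of all smaller
measures. -/
theorem IsTree.exists_subset_measure_eq {μ : Measure X} [IsFiniteMeasure μ] {T : Set (Set X)}
    (hT : IsTree μ T) {A : Set X} (hA : MeasurableSet A) {c : ℝ≥0∞} (hc : c ≤ μ A) :
    ∃ D ⊆ A, MeasurableSet D ∧ μ D = c := by
  obtain ⟨C, h⟩ := hT.exists_isChildMap
  -- The restriction of `μ` to `A` plays the role of `ν`; the union of the family is then cut down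
  -- to `A`.
  obtain ⟨S, hS, -, -, h2⟩ := h.exists_family hT.measurableSet
    (Measure.restrict_le_self (μ := μ) (s := A)) hT.univ_mem (c := c) (by simpa using hc)
  have hm : MeasurableSet (⋃₀ S) :=
    .sUnion (h.countable_tree.mono hS) fun I hI => hT.measurableSet I (hS hI)
  rw [Measure.restrict_apply hm] at h2
  exact ⟨_, inter_subset_right, hm.inter hA, h2⟩

/-! ### The maximal operator and its weak type inequality -/

section Maximal

variable {μ : Measure X} {T : Set (Set X)} {φ : X → ℝ}

theorem IsTree.measurable_maximal (hT : IsTree μ T) : Measurable (maximal μ T φ) := by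
  obtain ⟨C, h⟩ := hT.exists_isChildMap
  refine Measurable.biSup T h.countable_tree fun I hI => ?_
  have : (fun x => ⨆ _ : x ∈ I, (∫⁻ y in I, ‖φ y‖ₑ ∂μ) / μ I) =
      I.indicator fun _ => (∫⁻ y in I, ‖φ y‖ₑ ∂μ) / μ I := by
    ext x; by_cases hx : x ∈ I <;> simp [hx]
  rw [this]
  exact measurable_const.indicator (hT.measurableSet I hI)

theorem le_maximal {I : Set X} (hI : I ∈ T) {x : X} (hx : x ∈ I) :
    (∫⁻ y in I, ‖φ y‖ₑ ∂μ) / μ I ≤ maximal μ T φ x :=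
  le_iSup₂_of_le I hI (le_iSup_of_le hx le_rfl)

/-- The weak type inequality for the maximal operator. -/
theorem IsTree.mul_measure_maximal_le [IsFiniteMeasure μ] (hT : IsTree μ T) (l : ℝ≥0∞) :
    l * μ {x | l < maximal μ T φ x} ≤ ∫⁻ y in {x | l < maximal μ T φ x}, ‖φ y‖ₑ ∂μ := by
  obtain ⟨C, h⟩ := hT.exists_isChildMap
  -- The superlevel set is the union of the tree elements with average above `l`; once these are
  -- made disjoint, their inequalities add up.
  obtain ⟨D, hD, hdis, hun⟩ := h.exists_disjoint_subfamily
    (S := {I | I ∈ T ∧ l < (∫⁻ y in I, ‖φ y‖ₑ ∂μ) / μ I}) fun I hI => hI.1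
  have heq : {x | l < maximal μ T φ x} = ⋃₀ D := by
    rw [hun]; ext x
    simp only [maximal, mem_ofPred_eq, lt_iSup_iff, mem_sUnion]
    exact ⟨fun ⟨I, hI, hx, hl⟩ => ⟨I, ⟨hI, hl⟩, hx⟩, fun ⟨I, ⟨hI, hl⟩, hx⟩ => ⟨I, hI, hx, hl⟩⟩
  have hcD : D.Countable := h.countable_tree.mono fun I hI => (hD hI).1
  have hmD : ∀ I ∈ D, MeasurableSet I := fun I hI => hT.measurableSet I (hD hI).1
  rw [heq, measure_sUnion hcD hdis hmD, sUnion_eq_biUnion,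
    lintegral_biUnion hcD hmD hdis, ← ENNReal.tsum_mul_left]
  refine ENNReal.tsum_le_tsum fun I => ?_
  have := (hD I.2).2.le
  rwa [ENNReal.le_div_iff_mul_le (.inl (hT.measure_pos I (hD I.2).1).ne')
    (.inl (measure_ne_top _ _))] at this

end Maximal

/-! ### Monotonicity of $H_p$ and comparison with $\omega_p$ -/

theorem strictAntiOn_H {p : ℝ} (hp : 1 < p) : StrictAntiOn (H p) (Ici 1) := by
  have hc : ContinuousOn (H p) (Ici 1) := by
    refine ContinuousOn.add (continuousOn_const.mul ?_) (continuousOn_const.mul ?_) <;>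
      exact continuousOn_id.rpow_const fun x hx =>
        Or.inl (zero_lt_one.trans_le (mem_Ici.1 hx)).ne'
  refine strictAntiOn_of_deriv_neg (convex_Ici _) hc fun x hx => ?_
  rw [interior_Ici] at hx
  have hx1 : 1 < x := hx
  have hx0 : 0 < x := by linarith
  have hd : HasDerivAt (H p) (-(p - 1) * (p * x ^ (p - 1)) +
      p * ((p - 1) * x ^ (p - 1 - 1))) x :=
    ((Real.hasDerivAt_rpow_const (Or.inl hx0.ne')).const_mul _).add
      ((Real.hasDerivAt_rpow_const (Or.inl hx0.ne')).const_mul _)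
  rw [hd.deriv]
  have hlt : x ^ (p - 1 - 1) < x ^ (p - 1) := Real.rpow_lt_rpow_of_exponent_lt hx1 (by linarith)
  have : 0 < p * (p - 1) * (x ^ (p - 1) - x ^ (p - 1 - 1)) :=
    mul_pos (mul_pos (by linarith) (by linarith)) (by linarith)
  linarith

theorem omega_mem {p θ : ℝ} (hp : 1 < p) (hθ : θ ∈ Icc (0 : ℝ) 1) :
    omega p θ ∈ Icc 1 (p / (p - 1)) :=
  Function.invFunOn_mem ((bijOn_H hp).surjOn hθ)

theorem H_omega {p θ : ℝ} (hp : 1 < p) (hθ : θ ∈ Icc (0 : ℝ) 1) : H p (omega p θ) = θ :=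
  Function.invFunOn_eq ((bijOn_H hp).surjOn hθ)

/-- No bound `z ≤ p / (p - 1)` is needed, because $H_p$ decreases on all of $[1,\infty)$. This
matters for the upper bound, where `z` is a ratio of norms not known to be bounded beforehand. -/
theorem le_omega {p θ z : ℝ} (hp : 1 < p) (hθ : θ ∈ Icc (0 : ℝ) 1) (hz : 1 ≤ z)
    (h : θ ≤ H p z) : z ≤ omega p θ := by
  rwa [← H_omega hp hθ, (strictAntiOn_H hp).le_iff_ge (omega_mem hp hθ).1 hz] at h

theorem lt_H_of_lt_omega {p θ z : ℝ} (hp : 1 < p) (hθ : θ ∈ Icc (0 : ℝ) 1) (hz : 1 ≤ z)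
    (h : z < omega p θ) : θ < H p z := by
  conv_lhs => rw [← H_omega hp hθ]
  exact strictAntiOn_H hp hz (omega_mem hp hθ).1 h

/-! ### Jensen's inequality, a Doob type inequality and thresholds -/

section Real

variable {X : Type*} [MeasurableSpace X] {μ : Measure X}

/-- Jensen's inequality for the power `p` on a set of finite measure. -/
theorem setIntegral_rpow_div_le [IsFiniteMeasure μ] {φ : X → ℝ} {p : ℝ} (hp : 1 < p)
    (h0 : ∀ x, 0 ≤ φ x) (h1 : Integrable φ μ) (h2 : Integrable (fun x => φ x ^ p) μ) (E : Set X) :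
    (∫ x in E, φ x ∂μ) ^ p / μ.real E ^ (p - 1) ≤ ∫ x in E, φ x ^ p ∂μ := by
  have hnn : 0 ≤ ∫ x in E, φ x ^ p ∂μ := integral_nonneg fun x => Real.rpow_nonneg (h0 x) _
  -- On a null set the denominator is `0`, so the quotient takes the default value `0`.
  rcases (measureReal_nonneg (μ := μ) (s := E)).eq_or_lt with hE | hE
  · rw [← hE, Real.zero_rpow (by linarith), div_zero]
    exact hnn
  set m := (∫ x in E, φ x ∂μ) / μ.real E with hm
  have hm0 : 0 ≤ m := div_nonneg (integral_nonneg h0) hE.le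
  have hI : ∫ x in E, φ x ∂μ = m * μ.real E := by rw [hm]; field_simp
  -- The tangent line of $y \mapsto y^p$ at the mean `m`, obtained from Young's inequality.
  have hpt : ∀ x, p * m ^ (p - 1) * φ x - (p - 1) * m ^ p ≤ φ x ^ p := by
    intro x
    have := Real.young_inequality_of_nonneg (h0 x) (Real.rpow_nonneg hm0 (p - 1))
      (Real.HolderConjugate.conjExponent hp)
    rw [Real.conjExponent, ← Real.rpow_mul hm0,
      show (p - 1) * (p / (p - 1)) = p by field_simp [(sub_pos.2 hp).ne']] at this
    have hp0 : 0 < p := by linarith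
    have := mul_le_mul_of_nonneg_left this hp0.le
    have he : p * (φ x ^ p / p + m ^ p / (p / (p - 1))) = φ x ^ p + (p - 1) * m ^ p := by
      field_simp
    linarith
  have := integral_mono (μ := μ.restrict E)
    ((h1.restrict.const_mul (p * m ^ (p - 1))).sub (integrable_const ((p - 1) * m ^ p)))
    h2.restrict hpt
  rw [integral_sub' (h1.restrict.const_mul _) (integrable_const _), integral_const_mul, hI] at this
  simp only [integral_const, measureReal_restrict_apply_univ, smul_eq_mul] at this
  have hmp : m ^ (p - 1) * m = m ^ p := by
    rcases hm0.eq_or_lt with h | h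
    · rw [← h, Real.zero_rpow (by linarith : p ≠ 0), mul_zero]
    · rw [← Real.rpow_add_one h.ne', sub_add_cancel]
  have he : (∫ x in E, φ x ∂μ) ^ p / μ.real E ^ (p - 1) = m ^ p * μ.real E := by
    rw [hI, Real.mul_rpow hm0 hE.le, Real.rpow_sub_one hE.ne']
    have := (Real.rpow_pos_of_pos hE p).ne'
    field_simp
  rw [he]
  calc m ^ p * μ.real E = p * m ^ (p - 1) * (m * μ.real E) - μ.real E * ((p - 1) * m ^ p) := by
        rw [show p * m ^ (p - 1) * (m * μ.real E) = p * (m ^ (p - 1) * m) * μ.real E by ring, hmp]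
        ring
    _ ≤ _ := this

/-- A Doob type inequality: a weak type bound for `v` above the level `b` yields a bound for the
moments of `v`. -/
theorem integral_rpow_sub_le [IsFiniteMeasure μ] {φ v : X → ℝ} {p b N : ℝ} (hp : 1 < p)
    (hb : 0 < b) (hφm : Measurable φ) (h0 : ∀ x, 0 ≤ φ x) (h1 : Integrable φ μ)
    (hvm : Measurable v) (hbv : ∀ x, b ≤ v x) (hvN : ∀ x, v x ≤ N)
    (hw : ∀ l, b ≤ l → ENNReal.ofReal l * μ {x | l < v x} ≤
      ∫⁻ x in {x | l < v x}, ENNReal.ofReal (φ x) ∂μ) :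
    (p - 1) * ∫ x, (v x ^ p - b ^ p) ∂μ ≤ p * ∫ x, φ x * (v x ^ (p - 1) - b ^ (p - 1)) ∂μ := by
  have hprim : ∀ q : ℝ, 0 < q → ∀ y, 0 ≤ y →
      ∫ t in (0 : ℝ)..y, q * (t + b) ^ (q - 1) = (y + b) ^ q - b ^ q := by
    intro q hq y hy
    rw [intervalIntegral.integral_const_mul,
      intervalIntegral.integral_comp_add_right (fun t => t ^ (q - 1)),
      integral_rpow (.inl (by linarith)), zero_add, sub_add_cancel]
    field_simp
  have hcont : ∀ q : ℝ, ∀ t > 0,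
      IntervalIntegrable (fun t => q * (t + b) ^ (q - 1)) volume 0 t := by
    intro q t ht
    refine ContinuousOn.intervalIntegrable (continuousOn_const.mul ?_)
    refine (continuousOn_id.add continuousOn_const).rpow_const fun x hx => .inl ?_
    rw [uIcc_of_le ht.le] at hx
    exact (add_pos_of_nonneg_of_pos hx.1 hb).ne'
  have hnn : ∀ q : ℝ, 0 < q →
      ∀ᵐ t ∂volume.restrict (Ioi (0 : ℝ)), 0 ≤ q * (t + b) ^ (q - 1) := by
    intro q hq
    filter_upwards [ae_restrict_mem measurableSet_Ioi] with t ht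
    have : (0 : ℝ) < t := ht
    positivity
  -- Layer cake formula, with `t` the height above the base level `b`.
  have hlayer : ∀ (q : ℝ) (ν : Measure X), 0 < q →
      ∫⁻ x, ENNReal.ofReal (v x ^ q - b ^ q) ∂ν =
        ∫⁻ t in Ioi (0 : ℝ), ν {x | t < v x - b} * ENNReal.ofReal (q * (t + b) ^ (q - 1)) := by
    intro q ν hq
    rw [← lintegral_comp_eq_lintegral_meas_lt_mul ν
      (Eventually.of_forall fun x => sub_nonneg.2 (hbv x)) (hvm.sub_const b).aemeasurable
      (hcont q) (hnn q hq)]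
    refine lintegral_congr fun x => ?_
    rw [hprim q hq _ (sub_nonneg.2 (hbv x)), sub_add_cancel]
  have hp1 : 0 < p - 1 := sub_pos.2 hp
  have hp0 : 0 < p := by linarith
  set ν := μ.withDensity fun x => ENNReal.ofReal (φ x) with hν
  have hφo : Measurable fun x => ENNReal.ofReal (φ x) := hφm.ennreal_ofReal
  have key : ENNReal.ofReal (p - 1) * ∫⁻ x, ENNReal.ofReal (v x ^ p - b ^ p) ∂μ ≤
      ENNReal.ofReal p * ∫⁻ x, ENNReal.ofReal (v x ^ (p - 1) - b ^ (p - 1)) ∂ν := by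
    rw [hlayer p μ hp0, hlayer (p - 1) ν hp1, ← lintegral_const_mul' _ _ ENNReal.ofReal_ne_top,
      ← lintegral_const_mul' _ _ ENNReal.ofReal_ne_top]
    -- The integrands are compared level by level: this is the weak type inequality at `t + b`,
    -- multiplied by $p(p-1)(t+b)^{p-2}$.
    refine setLIntegral_mono' measurableSet_Ioi fun t ht => ?_
    have ht0 : (0 : ℝ) < t := ht
    have hset : {x | t < v x - b} = {x | t + b < v x} := by
      ext x; simp [lt_sub_iff_add_lt]
    have hwl := hw (t + b) (by linarith)
    rw [hset, hν, withDensity_apply _ (measurableSet_lt measurable_const hvm)]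
    have hpow : (t + b) ^ (p - 1) = (t + b) ^ (p - 1 - 1) * (t + b) := by
      rw [← Real.rpow_add_one (by positivity), sub_add_cancel]
    rw [hpow, ← mul_assoc p, ENNReal.ofReal_mul (by positivity), ENNReal.ofReal_mul hp0.le,
      ENNReal.ofReal_mul hp1.le]
    calc _ = ENNReal.ofReal p * ENNReal.ofReal (p - 1) *
            ENNReal.ofReal ((t + b) ^ (p - 1 - 1)) *
            (ENNReal.ofReal (t + b) * μ {x | t + b < v x}) := by ring
      _ ≤ ENNReal.ofReal p * ENNReal.ofReal (p - 1) *
            ENNReal.ofReal ((t + b) ^ (p - 1 - 1)) *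
            ∫⁻ x in {x | t + b < v x}, ENNReal.ofReal (φ x) ∂μ := by gcongr
      _ = _ := by ring
  have hmon : ∀ q : ℝ, 0 < q → ∀ x, 0 ≤ v x ^ q - b ^ q := fun q hq x =>
    sub_nonneg.2 (Real.rpow_le_rpow hb.le (hbv x) hq.le)
  have hmeas : ∀ q : ℝ, Measurable fun x => v x ^ q - b ^ q := fun q =>
    (hvm.pow_const q).sub_const _
  have hbd : ∀ q : ℝ, 0 < q → ∀ x, ‖v x ^ q - b ^ q‖ ≤ N ^ q := fun q hq x => by
    rw [Real.norm_of_nonneg (hmon q hq x)]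
    have := Real.rpow_le_rpow (hb.le.trans (hbv x)) (hvN x) hq.le
    have := Real.rpow_nonneg hb.le q
    linarith
  have hi1 : Integrable (fun x => v x ^ p - b ^ p) μ :=
    .of_bound (hmeas p).aestronglyMeasurable _ (Eventually.of_forall (hbd p hp0))
  have hi2 : Integrable (fun x => φ x * (v x ^ (p - 1) - b ^ (p - 1))) μ :=
    h1.mul_bdd (hmeas _).aestronglyMeasurable (Eventually.of_forall (hbd _ hp1))
  rw [hν, lintegral_withDensity_eq_lintegral_mul _ hφo (hmeas _).ennreal_ofReal] at key
  simp only [Pi.mul_apply, ← ENNReal.ofReal_mul (h0 _)] at key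
  rw [← ofReal_integral_eq_lintegral_ofReal hi1 (Eventually.of_forall (hmon p hp0)),
    ← ofReal_integral_eq_lintegral_ofReal hi2
      (Eventually.of_forall fun x => mul_nonneg (h0 x) (hmon _ hp1 x)),
    ← ENNReal.ofReal_mul hp1.le, ← ENNReal.ofReal_mul hp0.le] at key
  exact (ENNReal.ofReal_le_ofReal_iff (mul_nonneg hp0.le
    (integral_nonneg fun x => mul_nonneg (h0 x) (hmon _ hp1 x)))).1 key

/-- A threshold at which the superlevel sets of `g` in `A` pass the measure `c`. -/
theorem exists_threshold [IsFiniteMeasure μ] {g : X → ℝ≥0∞} (hg : Measurable g) {A : Set X}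
    (hA : MeasurableSet A) {c : ℝ≥0∞} (hc : c ≤ μ A) :
    ∃ r, μ (A ∩ {x | r < g x}) ≤ c ∧ c ≤ μ (A ∩ {x | r ≤ g x}) := by
  set R := {r | μ (A ∩ {x | r < g x}) ≤ c} with hR
  refine ⟨sInf R, ?_, ?_⟩
  · obtain ⟨u, hu, hlim, hmem⟩ := exists_seq_tendsto_sInf (S := R)
      ⟨⊤, by simp [hR]⟩ (OrderBot.bddBelow _)
    have : A ∩ {x | sInf R < g x} = ⋃ n, A ∩ {x | u n < g x} := by
      rw [← inter_iUnion]
      congr 1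
      ext x
      simp only [mem_ofPred_eq, mem_iUnion]
      exact ⟨fun hx => (hlim.eventually (gt_mem_nhds hx)).exists,
        fun ⟨n, hn⟩ => (sInf_le (hmem n)).trans_lt hn⟩
    rw [this, Monotone.measure_iUnion]
    · exact iSup_le hmem
    · exact fun m n hmn => inter_subset_inter_right _ fun x hx => (hu hmn).trans_lt hx
  · rcases (zero_le : 0 ≤ sInf R).eq_or_lt with h | h
    · rw [← h]; simpa using hc
    · obtain ⟨u, hu, hmem, hlim⟩ := exists_seq_strictMono_tendsto' h
      have : A ∩ {x | sInf R ≤ g x} = ⋂ n, A ∩ {x | u n < g x} := by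
        rw [← inter_iInter]
        congr 1
        ext x
        simp only [mem_ofPred_eq, mem_iInter]
        exact ⟨fun hx n => (hmem n).2.trans_le hx, fun hx => le_of_tendsto' hlim fun n => (hx n).le⟩
      rw [this, Antitone.measure_iInter]
      · exact le_iInf fun n => (not_le.1 fun hle => notMem_of_lt_csInf' (hmem n).2 hle).le
      · exact fun m n hmn => inter_subset_inter_right _
          fun x hx => (hu.monotone hmn).trans_lt hx
      · exact fun n => (hA.inter (measurableSet_lt measurable_const hg)).nullMeasurableSet
      · exact ⟨0, measure_ne_top _ _⟩

end Real

/-! ### The upper bound -/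

section UpperBound

variable {X : Type*} [MeasurableSpace X] {μ : Measure X} {T : Set (Set X)} {φ : X → ℝ}

/-- Taking the points where `φ` is largest, and part of a level set to hit the measure `c` exactly,
makes `φ` at least `r` on `D` and at most `r` on the rest of `A`. Hence the mean over `D` is no
smaller than the mean over `A`. -/
theorem IsTree.exists_subset_average [IsFiniteMeasure μ] (hT : IsTree μ T) (hφ : Measurable φ)
    (h0 : ∀ x, 0 ≤ φ x) (h1 : Integrable φ μ) {A : Set X} (hA : MeasurableSet A) {c : ℝ≥0∞}
    (hc : c ≤ μ A) :
    ∃ D ⊆ A, MeasurableSet D ∧ μ D = c ∧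
      μ.real D * ∫ x in A, φ x ∂μ ≤ μ.real A * ∫ x in D, φ x ∂μ := by
  obtain ⟨r, hr1, hr2⟩ := exists_threshold hφ.ennreal_ofReal hA hc
  have hm1 : MeasurableSet (A ∩ {x | r < ENNReal.ofReal (φ x)}) :=
    hA.inter (measurableSet_lt measurable_const hφ.ennreal_ofReal)
  have hm2 : MeasurableSet (A ∩ {x | r ≤ ENNReal.ofReal (φ x)}) :=
    hA.inter (measurableSet_le measurable_const hφ.ennreal_ofReal)
  have hsub : A ∩ {x | r < ENNReal.ofReal (φ x)} ⊆ A ∩ {x | r ≤ ENNReal.ofReal (φ x)} :=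
    inter_subset_inter_right _ fun x (hx : r < _) => hx.le
  obtain ⟨E, hE, hEm, hμE⟩ := hT.exists_subset_measure_eq (hm2.diff hm1)
    (c := c - μ (A ∩ {x | r < ENNReal.ofReal (φ x)})) (by
      rw [measure_sdiff hsub hm1.nullMeasurableSet (measure_ne_top _ _)]
      exact tsub_le_tsub_right hr2 _)
  set D := A ∩ {x | r < ENNReal.ofReal (φ x)} ∪ E with hD
  have hDA : D ⊆ A := union_subset inter_subset_left (hE.trans (sdiff_subset.trans inter_subset_left))
  have hDm : MeasurableSet D := hm1.union hEm
  have hμD : μ D = c := by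
    rw [hD, measure_union (disjoint_sdiff_right.mono_right hE) hEm, hμE]
    exact add_tsub_cancel_of_le hr1
  refine ⟨D, hDA, hDm, hμD, ?_⟩
  have hrle : ∀ x ∈ D, r ≤ ENNReal.ofReal (φ x) := by
    rintro x (hx | hx)
    exacts [le_of_lt hx.2, (hE hx).1.2]
  rcases D.eq_empty_or_nonempty with he | ⟨x, hx⟩
  · simp [he]
  have hrt : r ≠ ⊤ := ne_top_of_le_ne_top ENNReal.ofReal_ne_top (hrle x hx)
  have hd1 : r.toReal * μ.real D ≤ ∫ x in D, φ x ∂μ :=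
    setIntegral_ge_of_const_le_real hDm (measure_ne_top _ _)
      (fun x hx => ENNReal.toReal_le_of_le_ofReal (h0 x) (hrle x hx)) h1.integrableOn
  have hd2 : ∫ x in A \ D, φ x ∂μ ≤ r.toReal * μ.real (A \ D) := by
    rw [mul_comm, ← smul_eq_mul, ← setIntegral_const]
    refine setIntegral_mono_on h1.integrableOn (integrable_const _).integrableOn (hA.diff hDm)
      fun x hx => (ENNReal.ofReal_le_iff_le_toReal hrt).1 ?_
    exact not_lt.1 fun h => hx.2 (.inl ⟨hx.1, h⟩)
  have hs1 : ∫ x in A, φ x ∂μ = ∫ x in D, φ x ∂μ + ∫ x in A \ D, φ x ∂μ := by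
    rw [setIntegral_sdiff hDm h1.integrableOn hDA]; ring
  have hs2 : μ.real A = μ.real D + μ.real (A \ D) := by
    rw [measureReal_sdiff hDA hDm]; ring
  rw [hs1, hs2]
  nlinarith [mul_le_mul_of_nonneg_left hd1 (measureReal_nonneg (μ := μ) (s := A \ D)),
    mul_le_mul_of_nonneg_left hd2 (measureReal_nonneg (μ := μ) (s := D))]

theorem IsTree.lintegral_maximal_lt [IsFiniteMeasure μ] (hT : IsTree μ T)
    (h0 : ∀ x, 0 ≤ φ x) (l : ℝ) :
    ENNReal.ofReal l * μ {x | ENNReal.ofReal l < maximal μ T φ x} ≤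
      ∫⁻ x in {x | ENNReal.ofReal l < maximal μ T φ x}, ENNReal.ofReal (φ x) ∂μ := by
  have := hT.mul_measure_maximal_le (φ := φ) (ENNReal.ofReal l)
  simpa only [Real.enorm_of_nonneg (h0 _)] using this

theorem IsTree.mul_measureReal_maximal_lt [IsFiniteMeasure μ] (hT : IsTree μ T)
    (h0 : ∀ x, 0 ≤ φ x) (h1 : Integrable φ μ) {l : ℝ} (hl : 0 ≤ l) :
    l * μ.real {x | ENNReal.ofReal l < maximal μ T φ x} ≤
      ∫ x in {x | ENNReal.ofReal l < maximal μ T φ x}, φ x ∂μ := by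
  have := hT.lintegral_maximal_lt h0 l
  rw [← ofReal_integral_eq_lintegral_ofReal h1.integrableOn (Eventually.of_forall h0)] at this
  rw [← ENNReal.ofReal_le_ofReal_iff (integral_nonneg h0), ENNReal.ofReal_mul hl,
    ofReal_measureReal]
  exact this

/-- The non-strict superlevel set is the decreasing intersection of strict ones at levels increasing
to `l`. -/
theorem IsTree.mul_measureReal_maximal_le [IsFiniteMeasure μ] (hT : IsTree μ T)
    (h0 : ∀ x, 0 ≤ φ x) (h1 : Integrable φ μ) {l : ℝ} (hl : 0 ≤ l) :
    l * μ.real {x | ENNReal.ofReal l ≤ maximal μ T φ x} ≤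
      ∫ x in {x | ENNReal.ofReal l ≤ maximal μ T φ x}, φ x ∂μ := by
  rcases hl.eq_or_lt with rfl | hl
  · rw [zero_mul]; exact integral_nonneg h0
  obtain ⟨u, hu, hmem, hlim⟩ := exists_seq_strictMono_tendsto' hl
  have hset : {x | ENNReal.ofReal l ≤ maximal μ T φ x} =
      ⋂ n, {x | ENNReal.ofReal (u n) < maximal μ T φ x} := by
    ext x
    simp only [mem_ofPred_eq, mem_iInter]
    exact ⟨fun hx n => ((ENNReal.ofReal_lt_ofReal_iff hl).2 (hmem n).2).trans_le hx,
      fun hx => le_of_tendsto' (ENNReal.tendsto_ofReal hlim) fun n => (hx n).le⟩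
  have hint := tendsto_setIntegral_of_antitone (μ := μ) (f := φ)
    (s := fun n => {x | ENNReal.ofReal (u n) < maximal μ T φ x})
    (fun n => measurableSet_lt measurable_const hT.measurable_maximal)
    (fun m n hmn x hx => (ENNReal.ofReal_le_ofReal (hu.monotone hmn)).trans_lt hx)
    ⟨0, h1.integrableOn⟩
  rw [← hset] at hint
  refine le_of_tendsto_of_tendsto' (hlim.mul_const _) hint fun n => ?_
  refine le_trans ?_ (hT.mul_measureReal_maximal_lt h0 h1 (hmem n).1.le)
  refine mul_le_mul_of_nonneg_left (measureReal_mono fun x hx => ?_) (hmem n).1.le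
  exact ((ENNReal.ofReal_lt_ofReal_iff hl).2 (hmem n).2).trans_le hx

theorem IsTree.ofReal_integral_le_maximal [IsProbabilityMeasure μ] (hT : IsTree μ T)
    (h0 : ∀ x, 0 ≤ φ x) (h1 : Integrable φ μ) (x : X) :
    ENNReal.ofReal (∫ x, φ x ∂μ) ≤ maximal μ T φ x := by
  have := le_maximal (μ := μ) (φ := φ) hT.univ_mem (mem_univ x)
  rw [setLIntegral_univ, measure_univ, div_one] at this
  simp only [Real.enorm_of_nonneg (h0 _)] at this
  rwa [ofReal_integral_eq_lintegral_ofReal h1 (Eventually.of_forall h0)]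

/-- A set of measure `k` that contains the superlevel set of the maximal function at the height of
the average of `φ` over it. -/
theorem IsTree.exists_top_set [IsProbabilityMeasure μ] (hT : IsTree μ T) (hφ : Measurable φ)
    (h0 : ∀ x, 0 ≤ φ x) (h1 : Integrable φ μ) {k : ℝ} (hk0 : 0 < k) (hk1 : k ≤ 1) :
    ∃ D, MeasurableSet D ∧ μ.real D = k ∧ k * ∫ x, φ x ∂μ ≤ ∫ x in D, φ x ∂μ ∧
      {x | ENNReal.ofReal ((∫ x in D, φ x ∂μ) / k) < maximal μ T φ x} ⊆ D := by
  have hum := hT.measurable_maximal (φ := φ)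
  obtain ⟨r, hr1, hr2⟩ := exists_threshold (μ := μ) hum MeasurableSet.univ (c := ENNReal.ofReal k)
    (by rw [measure_univ]; exact ENNReal.ofReal_le_one.2 hk1)
  simp only [univ_inter] at hr1 hr2
  have hrt : r ≠ ⊤ := by
    -- An infinite threshold would violate the weak type inequality: at level `(f + 1) / k` the set
    -- has measure at least `k`, forcing $f + 1 \le \int\varphi = f$.
    rintro rfl
    set f := ∫ x, φ x ∂μ
    have hf : 0 ≤ f := integral_nonneg h0
    have hw := hT.mul_measureReal_maximal_lt h0 h1 (l := (f + 1) / k) (by positivity)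
    have hle : k ≤ μ.real {x | ENNReal.ofReal ((f + 1) / k) < maximal μ T φ x} := by
      rw [measureReal_def, ← ENNReal.ofReal_le_iff_le_toReal (measure_ne_top _ _)]
      exact hr2.trans (measure_mono fun x hx => ENNReal.ofReal_lt_top.trans_le hx)
    have h3 := setIntegral_le_integral (s := {x | ENNReal.ofReal ((f + 1) / k) < maximal μ T φ x})
      h1 (Eventually.of_forall h0)
    have h4 := mul_le_mul_of_nonneg_left hle (by positivity : 0 ≤ (f + 1) / k)
    rw [div_mul_cancel₀ _ hk0.ne'] at h4
    linarith
  obtain ⟨s, hs, rfl⟩ : ∃ s : ℝ, 0 ≤ s ∧ r = ENNReal.ofReal s :=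
    ⟨r.toReal, ENNReal.toReal_nonneg, (ENNReal.ofReal_toReal hrt).symm⟩
  set K₁ := {x | ENNReal.ofReal s < maximal μ T φ x} with hK₁
  set K₂ := {x | ENNReal.ofReal s ≤ maximal μ T φ x} with hK₂
  have hm₁ : MeasurableSet K₁ := measurableSet_lt measurable_const hum
  have hm₂ : MeasurableSet K₂ := measurableSet_le measurable_const hum
  have hsub : K₁ ⊆ K₂ := fun x (hx : ENNReal.ofReal s < _) => hx.le
  obtain ⟨E, hE, hEm, hμE, havg⟩ := hT.exists_subset_average hφ h0 h1 (hm₂.diff hm₁)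
    (c := ENNReal.ofReal k - μ K₁) (by
      rw [measure_sdiff hsub hm₁.nullMeasurableSet (measure_ne_top _ _)]
      exact tsub_le_tsub_right hr2 _)
  have hdisj : Disjoint K₁ E := disjoint_sdiff_right.mono_right hE
  have hμD : μ (K₁ ∪ E) = ENNReal.ofReal k := by
    rw [measure_union hdisj hEm, hμE]
    exact add_tsub_cancel_of_le hr1
  have hμD' : μ.real (K₁ ∪ E) = k := by rw [measureReal_def, hμD, ENNReal.toReal_ofReal hk0.le]
  -- The weak type inequality holds on both `K₁` and `K₂`. As `E` has at least the average mass of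
  -- `K₂ \ K₁`, it persists on the intermediate set `K₁ ∪ E`, so `s` is at most the mean of `φ`
  -- there.
  have hsk : s * k ≤ ∫ x in K₁ ∪ E, φ x ∂μ := by
    have hw1 := hT.mul_measureReal_maximal_lt h0 h1 hs
    have hw2 := hT.mul_measureReal_maximal_le h0 h1 hs
    rw [← hK₁] at hw1
    rw [← hK₂] at hw2
    have e1 : ∫ x in K₁ ∪ E, φ x ∂μ = ∫ x in K₁, φ x ∂μ + ∫ x in E, φ x ∂μ :=
      setIntegral_union hdisj hEm h1.integrableOn h1.integrableOn
    have e2 : ∫ x in K₂ \ K₁, φ x ∂μ = ∫ x in K₂, φ x ∂μ - ∫ x in K₁, φ x ∂μ :=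
      setIntegral_sdiff hm₁ h1.integrableOn hsub
    have e3 : μ.real (K₂ \ K₁) = μ.real K₂ - μ.real K₁ := measureReal_sdiff hsub hm₁
    have e4 : k = μ.real K₁ + μ.real E := by rw [← measureReal_union hdisj hEm, hμD']
    have e5 : μ.real E ≤ μ.real (K₂ \ K₁) := measureReal_mono hE
    have hE0 : 0 ≤ μ.real E := measureReal_nonneg
    have hEi : 0 ≤ ∫ x in E, φ x ∂μ := integral_nonneg h0
    rw [e1, e4]
    rw [e2] at havg
    rw [e3] at havg e5
    rcases hE0.eq_or_lt with hz | hpos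
    · rw [← hz]; linarith
    · have hm : 0 < μ.real K₂ - μ.real K₁ := hpos.trans_le e5
      refine le_of_mul_le_mul_left ?_ hm
      nlinarith [mul_le_mul_of_nonneg_left hw1 (sub_nonneg.2 e5),
        mul_le_mul_of_nonneg_left hw2 hE0]
  refine ⟨K₁ ∪ E, hm₁.union hEm, hμD', ?_, fun x hx => .inl ?_⟩
  · rcases lt_or_ge s (∫ x, φ x ∂μ) with hlt | hge
    · have hK : K₁ = univ := eq_univ_of_forall fun x =>
        ((ENNReal.ofReal_lt_ofReal_iff (hs.trans_lt hlt)).2 hlt).trans_le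
          (hT.ofReal_integral_le_maximal h0 h1 x)
      rw [hK, univ_union, setIntegral_univ]
      exact mul_le_of_le_one_left (integral_nonneg h0) hk1
    · exact le_trans (by rw [mul_comm]; exact mul_le_mul_of_nonneg_right hge hk0.le) hsk
  · refine lt_of_le_of_lt (ENNReal.ofReal_le_ofReal ?_) hx
    rwa [le_div_iff₀ hk0]

/-- The estimate of the truncated maximal function over a set of measure `k`. -/
theorem IsTree.moment_inequality [IsProbabilityMeasure μ] (hT : IsTree μ T) (hφ : Measurable φ)
    (h0 : ∀ x, 0 ≤ φ x) (h1 : Integrable φ μ) {p : ℝ} (hp : 1 < p)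
    (h2 : Integrable (fun x => φ x ^ p) μ) {D : Set X}
    {A θ b N : ℝ} (hb : 0 < b) (hbN : b ≤ N)
    (htop : {x | ENNReal.ofReal b < maximal μ T φ x} ⊆ D) (hav : ∫ x in D, φ x ∂μ = b * μ.real D)
    (hA0 : 0 < A) (hA : ∫ x in D, φ x ^ p ∂μ ≤ A) (hθ : θ ∈ Icc (0 : ℝ) 1)
    (hθA : θ * A = μ.real D * b ^ p) {K : Set X} (hKD : μ.real K = μ.real D) :
    ∫⁻ x in K, min (maximal μ T φ x) (ENNReal.ofReal N) ^ p ∂μ ≤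
      ENNReal.ofReal (A * omega p θ ^ p) := by
  set u := maximal μ T φ with hu
  have hum : Measurable u := hT.measurable_maximal
  have hp0 : 0 < p := by linarith
  have hp1 : 0 < p - 1 := by linarith
  -- The cut at `N` makes all moments finite; the floor `b` makes `v` constant off `D`.
  set v : X → ℝ := fun x => (max (ENNReal.ofReal b) (min (u x) (ENNReal.ofReal N))).toReal with hv
  have hne : ∀ x, max (ENNReal.ofReal b) (min (u x) (ENNReal.ofReal N)) ≠ ⊤ := fun x =>
    (max_lt ENNReal.ofReal_lt_top ((min_le_right _ _).trans_lt ENNReal.ofReal_lt_top)).ne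
  have hvof : ∀ x, ENNReal.ofReal (v x) = max (ENNReal.ofReal b) (min (u x) (ENNReal.ofReal N)) :=
    fun x => ENNReal.ofReal_toReal (hne x)
  have hvm : Measurable v := (measurable_const.max (hum.min measurable_const)).ennreal_toReal
  have hbv : ∀ x, b ≤ v x := fun x =>
    (ENNReal.ofReal_le_iff_le_toReal (hne x)).1 (le_max_left _ _)
  have hvN : ∀ x, v x ≤ N := fun x => ENNReal.toReal_le_of_le_ofReal (hb.le.trans hbN)
    (max_le (ENNReal.ofReal_le_ofReal hbN) (min_le_right _ _))
  have hlt : ∀ l, b ≤ l → ∀ x, l < v x ↔ ENNReal.ofReal l < u x ∧ l < N := by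
    intro l hl x
    have hl0 : 0 ≤ l := hb.le.trans hl
    rw [← ENNReal.ofReal_lt_ofReal_iff_of_nonneg hl0, hvof, lt_max_iff, lt_min_iff,
      ENNReal.ofReal_lt_ofReal_iff_of_nonneg hl0, ENNReal.ofReal_lt_ofReal_iff_of_nonneg hl0]
    exact or_iff_right hl.not_gt
  have hdoob := integral_rpow_sub_le (μ := μ) hp hb hφ h0 h1 hvm hbv hvN (fun l hl => by
    by_cases hlN : l < N
    · have : {x | l < v x} = {x | ENNReal.ofReal l < u x} := by
        ext x; exact (hlt l hl x).trans (and_iff_left hlN)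
      rw [this]
      exact hT.lintegral_maximal_lt h0 l
    · have : {x | l < v x} = ∅ :=
        eq_empty_of_forall_notMem fun x hx => hlN ((hlt l hl x).1 hx).2
      simp [this])
  have hoff : ∀ x ∉ D, v x = b := fun x hx => by
    refine le_antisymm (not_lt.1 fun h => hx (htop ?_)) (hbv x)
    exact ((hlt b le_rfl x).1 h).1
  have hmeas : ∀ q : ℝ, Measurable fun x => v x ^ q := fun q => hvm.pow_const q
  have hnn : ∀ (q : ℝ) (x : X), 0 ≤ v x ^ q := fun q x => Real.rpow_nonneg (hb.le.trans (hbv x)) _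
  have hbd : ∀ q : ℝ, 0 < q → ∀ x, ‖v x ^ q‖ ≤ N ^ q := fun q hq x => by
    rw [Real.norm_of_nonneg (hnn q x)]
    exact Real.rpow_le_rpow (hb.le.trans (hbv x)) (hvN x) hq.le
  have hiv : Integrable (fun x => v x ^ p) μ :=
    .of_bound (hmeas p).aestronglyMeasurable _ (Eventually.of_forall (hbd p hp0))
  have hiφ : Integrable (fun x => φ x * v x ^ (p - 1)) μ :=
    h1.mul_bdd (hmeas _).aestronglyMeasurable (Eventually.of_forall (hbd _ hp1))
  set I := ∫ x in D, v x ^ p ∂μ with hI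
  have hIe : ∫ x, (v x ^ p - b ^ p) ∂μ = I - μ.real D * b ^ p := by
    rw [← setIntegral_eq_integral_of_forall_compl_eq_zero (s := D)
      fun x hx => by rw [hoff x hx, sub_self],
      integral_sub hiv.integrableOn (integrable_const _).integrableOn, setIntegral_const,
      smul_eq_mul]
  have hb' : b * b ^ (p - 1) = b ^ p := by
    rw [mul_comm, ← Real.rpow_add_one hb.ne', sub_add_cancel]
  have hJe : ∫ x, φ x * (v x ^ (p - 1) - b ^ (p - 1)) ∂μ =
      ∫ x in D, φ x * v x ^ (p - 1) ∂μ - μ.real D * b ^ p := by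
    rw [← setIntegral_eq_integral_of_forall_compl_eq_zero (s := D)
      fun x hx => by rw [hoff x hx, sub_self, mul_zero]]
    simp only [mul_sub]
    rw [integral_sub hiφ.integrableOn (h1.mul_const _).integrableOn, integral_mul_const, hav,
      ← hb']
    ring
  rw [hIe, hJe] at hdoob
  have hmain : (p - 1) * I + θ * A ≤ p * ∫ x in D, φ x * v x ^ (p - 1) ∂μ := by
    rw [hθA]; linarith
  -- Young's inequality with a free weight `σ`; the choice of `σ` below turns it into Hölder's
  -- inequality.
  have hyoung : ∀ σ : ℝ, 0 < σ → p * ∫ x in D, φ x * v x ^ (p - 1) ∂μ ≤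
      σ ^ (p - 1) * A + (p - 1) * I / σ := by
    intro σ hσ
    have hpt : ∀ x, φ x * v x ^ (p - 1) ≤
        σ ^ (p - 1) / p * φ x ^ p + (p - 1) / (p * σ) * v x ^ p := by
      intro x
      have hv0 : 0 < v x := hb.trans_le (hbv x)
      have := Real.young_inequality_of_nonneg (h0 x) (Real.rpow_nonneg (div_pos hv0 hσ).le (p - 1))
        (Real.HolderConjugate.conjExponent hp)
      rw [Real.conjExponent, ← Real.rpow_mul (div_pos hv0 hσ).le,
        show (p - 1) * (p / (p - 1)) = p by field_simp, Real.div_rpow hv0.le hσ.le,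
        Real.div_rpow hv0.le hσ.le] at this
      have hσ1 : σ ^ p = σ ^ (p - 1) * σ := by rw [← Real.rpow_add_one hσ.ne', sub_add_cancel]
      have hσ2 : 0 < σ ^ (p - 1) := Real.rpow_pos_of_pos hσ _
      have h3 := mul_le_mul_of_nonneg_left this hσ2.le
      rw [hσ1] at h3
      calc φ x * v x ^ (p - 1) = σ ^ (p - 1) * (φ x * (v x ^ (p - 1) / σ ^ (p - 1))) := by
            field_simp
        _ ≤ _ := h3
        _ = _ := by field_simp
    have h3 := integral_mono (μ := μ.restrict D) hiφ.restrict
      ((h2.restrict.const_mul (σ ^ (p - 1) / p)).add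
        (hiv.restrict.const_mul ((p - 1) / (p * σ)))) hpt
    rw [integral_add' (h2.restrict.const_mul _) (hiv.restrict.const_mul _), integral_const_mul,
      integral_const_mul, ← hI] at h3
    calc p * ∫ x in D, φ x * v x ^ (p - 1) ∂μ
        ≤ p * (σ ^ (p - 1) / p * ∫ x in D, φ x ^ p ∂μ + (p - 1) / (p * σ) * I) := by gcongr
      _ = σ ^ (p - 1) * ∫ x in D, φ x ^ p ∂μ + (p - 1) * I / σ := by field_simp
      _ ≤ _ := by gcongr
  have hIpos : 0 ≤ I := integral_nonneg fun x => hnn p x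
  have hz := (omega_mem hp hθ).1
  have hIle : I ≤ A * omega p θ ^ p := by
    by_contra! hcon
    set σ := (I / A) ^ p⁻¹ with hσ
    have hσp : σ ^ p = I / A := Real.rpow_inv_rpow (div_nonneg hIpos hA0.le) hp0.ne'
    have hσ0 : 0 ≤ σ := Real.rpow_nonneg (div_nonneg hIpos hA0.le) _
    have hzσ : omega p θ < σ := by
      rw [← Real.rpow_lt_rpow_iff (by linarith) hσ0 hp0, hσp, lt_div_iff₀ hA0, mul_comm]
      exact hcon
    have hσpos : 0 < σ := by linarith
    have hIσ : I = A * (σ ^ (p - 1) * σ) := by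
      rw [← Real.rpow_add_one hσpos.ne', sub_add_cancel, hσp]; field_simp
    have h3 := hmain.trans (hyoung σ hσpos)
    have hH : θ ≤ H p σ := by
      refine le_of_mul_le_mul_right ?_ hA0
      have e1 : (p - 1) * I / σ = (p - 1) * A * σ ^ (p - 1) := by rw [hIσ]; field_simp
      have e2 : H p σ * A = -((p - 1) * I) + p * σ ^ (p - 1) * A := by
        rw [H, hσp]; field_simp
      rw [e1] at h3
      rw [e2]; linarith
    exact absurd (le_omega hp hθ (by linarith) hH) (not_le.2 hzσ)
  calc ∫⁻ x in K, min (u x) (ENNReal.ofReal N) ^ p ∂μ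
      ≤ ∫⁻ x in K, ENNReal.ofReal (v x ^ p) ∂μ := by
        refine lintegral_mono fun x => ?_
        rw [← ENNReal.ofReal_rpow_of_nonneg (hb.le.trans (hbv x)) hp0.le, hvof]
        exact ENNReal.rpow_le_rpow (le_max_right _ _) hp0.le
    _ = ENNReal.ofReal (∫ x in K, v x ^ p ∂μ) :=
        (ofReal_integral_eq_lintegral_ofReal hiv.restrict (Eventually.of_forall (hnn p))).symm
    _ ≤ ENNReal.ofReal I := by
        refine ENNReal.ofReal_le_ofReal ?_
        -- Only here does `K` enter: the excess over `K` is at most the total excess, all of which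
        -- lies in `D`, and both sets have the same measure.
        have h3 : ∫ x in K, (v x ^ p - b ^ p) ∂μ ≤ ∫ x, (v x ^ p - b ^ p) ∂μ :=
          setIntegral_le_integral (hiv.sub (integrable_const _)) (Eventually.of_forall fun x =>
            sub_nonneg.2 (Real.rpow_le_rpow hb.le (hbv x) hp0.le))
        rw [hIe, integral_sub hiv.integrableOn (integrable_const _).integrableOn,
          setIntegral_const, smul_eq_mul, hKD] at h3
        linarith
    _ ≤ _ := ENNReal.ofReal_le_ofReal hIle

/-- The upper bound: the integral of the maximal function is dominated by a value of `Rfun` at an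
admissible point. -/
theorem IsTree.exists_lintegral_le [IsProbabilityMeasure μ] (hT : IsTree μ T) (hφ : Measurable φ)
    (h0 : ∀ x, 0 ≤ φ x) (h1 : Integrable φ μ) {p : ℝ} (hp : 1 < p)
    (h2 : Integrable (fun x => φ x ^ p) μ) {f F k : ℝ} (hf : 0 < f) (hk0 : 0 < k) (hk1 : k ≤ 1)
    (hφf : ∫ x, φ x ∂μ = f) (hφF : ∫ x, φ x ^ p ∂μ = F) {K : Set X}
    (hKk : μ K = ENNReal.ofReal k) :
    ∃ B ∈ admissible p f F k,
      ∫⁻ x in K, max (maximal μ T φ x) (ENNReal.ofReal f) ^ p ∂μ ≤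
        ENNReal.ofReal (Rfun p f F k B) := by
  have hp0 : 0 < p := by linarith
  obtain ⟨D, hD, hDk, hfB, htop⟩ := hT.exists_top_set hφ h0 h1 hk0 hk1
  rw [hφf] at hfB
  set B := ∫ x in D, φ x ∂μ with hB
  have hBpos : 0 < B := (mul_pos hk0 hf).trans_le hfB
  have hBf : B ≤ f := hφf ▸ setIntegral_le_integral h1 (Eventually.of_forall h0)
  have hc1 : ∫ x in Dᶜ, φ x ∂μ = f - B := by
    rw [← hφf, ← integral_add_compl hD h1]; ring
  have hc2 : ∫ x in Dᶜ, φ x ^ p ∂μ = F - ∫ x in D, φ x ^ p ∂μ := by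
    rw [← hφF, ← integral_add_compl hD h2]; ring
  -- Jensen on `Dᶜ` bounds $\int_D\varphi^p$ by $A_k(B)$. Together with Jensen on `D` it gives
  -- admissibility of `B` and $\theta \le 1$.
  have hj1 := setIntegral_rpow_div_le hp h0 h1 h2 D
  have hj2 := setIntegral_rpow_div_le hp h0 h1 h2 Dᶜ
  rw [← hB, hDk] at hj1
  rw [hc1, hc2, probReal_compl_eq_one_sub hD, hDk] at hj2
  have hkp : 0 < k ^ (p - 1) := Real.rpow_pos_of_pos hk0 _
  have hBA : B ^ p / k ^ (p - 1) ≤ Afun p f F k B := by unfold Afun; linarith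
  have hBkp : 0 < B ^ p / k ^ (p - 1) := div_pos (Real.rpow_pos_of_pos hBpos _) hkp
  have hA0 : 0 < Afun p f F k B := hBkp.trans_le hBA
  refine ⟨B, ⟨⟨hBpos.le, hBf⟩, ?_, ?_⟩, ?_⟩
  · unfold hfun; linarith
  · rintro rfl
    have : μ Dᶜ = 0 := by
      rw [← measureReal_eq_zero_iff, probReal_compl_eq_one_sub hD, hDk, sub_self]
    rw [setIntegral_measure_zero _ this] at hc1
    linarith
  have hθe : B ^ p / (k ^ (p - 1) * Afun p f F k B) =
      B ^ p / k ^ (p - 1) / Afun p f F k B := by rw [div_div]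
  have hθ : B ^ p / (k ^ (p - 1) * Afun p f F k B) ∈ Icc (0 : ℝ) 1 := by
    rw [hθe]; exact ⟨(div_pos hBkp hA0).le, (div_le_one hA0).2 hBA⟩
  have hθA : B ^ p / (k ^ (p - 1) * Afun p f F k B) * Afun p f F k B =
      μ.real D * (B / k) ^ p := by
    rw [hθe, div_mul_cancel₀ _ hA0.ne', hDk, Real.div_rpow hBpos.le hk0.le,
      Real.rpow_sub_one hk0.ne']
    have := (Real.rpow_pos_of_pos hk0 p).ne'
    field_simp
  have hKD : μ.real K = μ.real D := by
    rw [hDk, measureReal_def, hKk, ENNReal.toReal_ofReal hk0.le]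
  have hmax : ∀ x, max (maximal μ T φ x) (ENNReal.ofReal f) = maximal μ T φ x := fun x =>
    max_eq_left (hφf ▸ hT.ofReal_integral_le_maximal h0 h1 x)
  have hsup : ∀ x, maximal μ T φ x ^ p =
      ⨆ n : ℕ, min (maximal μ T φ x) (ENNReal.ofReal (max (B / k) n)) ^ p := by
    intro x
    have hmono : Monotone fun n : ℕ =>
        min (maximal μ T φ x) (ENNReal.ofReal (max (B / k) n)) ^ p := fun m n hmn => by
      dsimp only; gcongr
    refine tendsto_nhds_unique ?_ (tendsto_atTop_iSup hmono)
    have ht : Tendsto (fun n : ℕ => ENNReal.ofReal (max (B / k) n)) atTop (𝓝 ⊤) :=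
      ENNReal.tendsto_ofReal_nhds_top.2
        (tendsto_atTop_mono (fun n => le_max_right _ _) tendsto_natCast_atTop_atTop)
    have := (ENNReal.continuous_rpow_const (y := p)).continuousAt.tendsto.comp
      ((tendsto_const_nhds (x := maximal μ T φ x)).min ht)
    rwa [min_top_right] at this
  simp only [hmax]
  rw [lintegral_congr hsup, lintegral_iSup
    (fun n => (hT.measurable_maximal.min measurable_const).pow_const p)
    (fun m n hmn x => by dsimp only; gcongr)]
  refine iSup_le fun n => ?_
  exact hT.moment_inequality hφ h0 h1 hp h2 (div_pos hBpos hk0) (le_max_left _ _) htop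
    (by rw [← hB, hDk, div_mul_cancel₀ _ hk0.ne']) hA0 (by unfold Afun; linarith) hθ hθA hKD

end UpperBound

/-! ### Iterated refinement of families of sets -/

section Refine

variable {X : Type*}

/-- Replace every member `J` of a family of sets by the family `R J`. -/
def refineFamily (R : Set X → Set (Set X)) (S : Set (Set X)) : Set (Set X) := ⋃ J ∈ S, R J

variable {R : Set X → Set (Set X)} {S T : Set (Set X)}

theorem refineFamily_subset (hR : ∀ J ∈ T, R J ⊆ T) (hS : S ⊆ T) : refineFamily R S ⊆ T :=
  iUnion₂_subset fun J hJ => hR J (hS hJ)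

theorem iterate_refineFamily_subset (hR : ∀ J ∈ T, R J ⊆ T) (hS : S ⊆ T) (n : ℕ) :
    (refineFamily R)^[n] S ⊆ T := by
  induction n generalizing S with
  | zero => exact hS
  | succ n ih => exact ih (refineFamily_subset hR hS)

theorem sUnion_refineFamily_subset (hs : ∀ J ∈ S, ⋃₀ R J ⊆ J) : ⋃₀ refineFamily R S ⊆ ⋃₀ S := by
  rintro x ⟨I, hI, hx⟩
  obtain ⟨J, hJ, hI⟩ := mem_iUnion₂.1 hI
  exact ⟨J, hJ, hs J hJ ⟨I, hI, hx⟩⟩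

theorem sUnion_iterate_refineFamily_subset (hR : ∀ J ∈ T, R J ⊆ T) (hs : ∀ J ∈ T, ⋃₀ R J ⊆ J)
    (hS : S ⊆ T) (n : ℕ) : ⋃₀ (refineFamily R)^[n] S ⊆ ⋃₀ S := by
  induction n generalizing S with
  | zero => exact Subset.rfl
  | succ n ih =>
    exact (ih (refineFamily_subset hR hS)).trans
      (sUnion_refineFamily_subset fun J hJ => hs J (hS hJ))

theorem pairwiseDisjoint_refineFamily (hs : ∀ J ∈ S, ⋃₀ R J ⊆ J)
    (hd : ∀ J ∈ S, (R J).PairwiseDisjoint id) (hS : S.PairwiseDisjoint id) :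
    (refineFamily R S).PairwiseDisjoint id := by
  intro I hI I' hI' hne
  obtain ⟨J, hJ, hI⟩ := mem_iUnion₂.1 hI
  obtain ⟨J', hJ', hI'⟩ := mem_iUnion₂.1 hI'
  by_cases he : J = J'
  · subst he
    exact hd J hJ hI hI' hne
  · exact (hS hJ hJ' he).mono ((subset_sUnion_of_mem hI).trans (hs J hJ))
      ((subset_sUnion_of_mem hI').trans (hs J' hJ'))

theorem iterate_refineFamily_eq_biUnion (n : ℕ) (S : Set (Set X)) :
    (refineFamily R)^[n] S = ⋃ J ∈ S, (refineFamily R)^[n] {J} := by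
  induction n generalizing S with
  | zero => simp
  | succ n ih =>
    simp only [Function.iterate_succ_apply]
    rw [ih]
    conv_rhs => enter [1, J, 1, hJ]; rw [ih]
    simp only [refineFamily, biUnion_iUnion, biUnion_singleton]

/-- Refinement acts on each member separately, so what later generations leave inside `J` is what
refining `J` alone produces. This localises the measure decay to each element. -/
theorem inter_sUnion_iterate_refineFamily (hR : ∀ J ∈ T, R J ⊆ T) (hs : ∀ J ∈ T, ⋃₀ R J ⊆ J)
    (hS : S ⊆ T) (hd : S.PairwiseDisjoint id) {J : Set X} (hJ : J ∈ S) (n : ℕ) :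
    J ∩ ⋃₀ (refineFamily R)^[n] S = ⋃₀ (refineFamily R)^[n] {J} := by
  have hsub : ∀ I ∈ S, ⋃₀ (refineFamily R)^[n] {I} ⊆ I := fun I hI => by
    have := sUnion_iterate_refineFamily_subset hR hs (singleton_subset_iff.2 (hS hI)) n
    rwa [sUnion_singleton] at this
  rw [iterate_refineFamily_eq_biUnion n S]
  refine Subset.antisymm ?_ fun x hx => ⟨hsub J hJ hx, ?_⟩
  · rintro x ⟨hxJ, I, hI, hx⟩
    obtain ⟨J', hJ', hI⟩ := mem_iUnion₂.1 hI
    have : J' = J := hd.elim_set hJ' hJ x (hsub J' hJ' ⟨I, hI, hx⟩) hxJ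
    exact this ▸ ⟨I, hI, hx⟩
  · obtain ⟨I, hI, hx⟩ := hx
    exact ⟨I, mem_iUnion₂.2 ⟨J, hJ, hI⟩, hx⟩

end Refine

/-! ### Nested families with geometric decay -/

section Nested

variable {X : Type*} [MeasurableSpace X] {μ : Measure X} {T : Set (Set X)}

/-- Nested disjoint families of elements of the tree whose unions decay geometrically in every
element of every family. -/
theorem IsTree.exists_nested_families [IsFiniteMeasure μ] (hT : IsTree μ T) {q c : ℝ≥0∞}
    (hq : q ≤ 1) (hc : c ≤ μ univ) :
    ∃ S : ℕ → Set (Set X), (∀ n, S n ⊆ T) ∧ (∀ n, ⋃₀ S (n + 1) ⊆ ⋃₀ S n) ∧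
      (∀ n, μ (⋃₀ S n) = q ^ n * c) ∧
      ∀ n, ∀ J ∈ S n, ∀ m, μ (J ∩ ⋃₀ S (n + m)) = q ^ m * μ J := by
  obtain ⟨C, h⟩ := hT.exists_isChildMap
  obtain ⟨S₀, hS₀, hd₀, -, hμ₀⟩ := h.exists_family hT.measurableSet le_rfl hT.univ_mem hc
  have hfam : ∀ J, ∃ S, J ∈ T → S ⊆ T ∧ S.PairwiseDisjoint id ∧ ⋃₀ S ⊆ J ∧ μ (⋃₀ S) = q * μ J := by
    intro J
    by_cases hJ : J ∈ T
    · obtain ⟨S, hS⟩ := h.exists_family hT.measurableSet le_rfl hJ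
        (mul_le_of_le_one_left (zero_le : 0 ≤ μ J) hq)
      exact ⟨S, fun _ => hS⟩
    · exact ⟨∅, fun h => absurd h hJ⟩
  choose R hR using hfam
  have hRT : ∀ J ∈ T, R J ⊆ T := fun J hJ => (hR J hJ).1
  have hRJ : ∀ J ∈ T, ⋃₀ R J ⊆ J := fun J hJ => (hR J hJ).2.2.1
  have hsucc : ∀ n (S : Set (Set X)),
      (refineFamily R)^[n + 1] S = refineFamily R ((refineFamily R)^[n] S) :=
    fun n S => Function.iterate_succ_apply' _ _ _
  have hdis : ∀ n (S : Set (Set X)), S ⊆ T → S.PairwiseDisjoint id →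
      ((refineFamily R)^[n] S).PairwiseDisjoint id := by
    intro n S hS hd
    induction n with
    | zero => exact hd
    | succ n ih =>
      have := iterate_refineFamily_subset hRT hS n
      rw [hsucc]
      exact pairwiseDisjoint_refineFamily (fun J hJ => hRJ J (this hJ))
        (fun J hJ => (hR J (this hJ)).2.1) ih
  have hone : ∀ S : Set (Set X), S ⊆ T → S.PairwiseDisjoint id →
      μ (⋃₀ refineFamily R S) = q * μ (⋃₀ S) := by
    intro S hS hd
    have hcS : S.Countable := h.countable_tree.mono hS
    have hm : ∀ J ∈ S, MeasurableSet (⋃₀ R J) := fun J hJ =>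
      .sUnion (h.countable_tree.mono (hRT J (hS hJ))) fun I hI =>
        hT.measurableSet I (hRT J (hS hJ) hI)
    have he : ⋃₀ refineFamily R S = ⋃ J ∈ S, ⋃₀ R J := by
      simp only [refineFamily, sUnion_iUnion]
    rw [he, measure_biUnion hcS (fun J hJ J' hJ' hne =>
      (hd hJ hJ' hne).mono (hRJ J (hS hJ)) (hRJ J' (hS hJ'))) hm,
      measure_sUnion hcS hd fun J hJ => hT.measurableSet J (hS hJ), ← ENNReal.tsum_mul_left]
    exact tsum_congr fun J => (hR J (hS J.2)).2.2.2
  have hpow : ∀ n (S : Set (Set X)), S ⊆ T → S.PairwiseDisjoint id →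
      μ (⋃₀ (refineFamily R)^[n] S) = q ^ n * μ (⋃₀ S) := by
    intro n S hS hd
    induction n with
    | zero => simp
    | succ n ih =>
      rw [hsucc, hone _ (iterate_refineFamily_subset hRT hS n) (hdis n S hS hd), ih, pow_succ]
      ring
  have hsub : ∀ n, (refineFamily R)^[n] S₀ ⊆ T := iterate_refineFamily_subset hRT hS₀
  refine ⟨fun n => (refineFamily R)^[n] S₀, hsub, fun n => ?_, fun n => ?_, fun n J hJ m => ?_⟩
  · dsimp only
    rw [hsucc]
    exact sUnion_refineFamily_subset fun J hJ => hRJ J (hsub n hJ)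
  · rw [hpow n S₀ hS₀ hd₀, hμ₀]
  · have hJT : {J} ⊆ T := singleton_subset_iff.2 (hsub n hJ)
    dsimp only
    rw [add_comm, Function.iterate_add_apply, inter_sUnion_iterate_refineFamily hRT hRJ (hsub n)
      (hdis n S₀ hS₀ hd₀) hJ, hpow m {J} hJT (pairwiseDisjoint_singleton _ _), sUnion_singleton]

/-- If the measures of `J ∩ A (n + m)` decay geometrically, then almost every point of `J` leaves
the sequence `A`. -/
theorem ae_exists_mem_sdiff [IsFiniteMeasure μ] {A : ℕ → Set X} {a : ℝ} (ha0 : 0 < a) (ha1 : a < 1)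
    {J : Set X} (hJ : MeasurableSet J) {n : ℕ} (hJA : J ⊆ A n)
    (hμ : ∀ m, μ.real (J ∩ A (n + m)) = (1 - a) ^ m * μ.real J) :
    ∀ᵐ x ∂μ.restrict J, ∃ m, x ∈ A (n + m) \ A (n + m + 1) := by
  rw [ae_restrict_iff' hJ, ae_iff]
  refine measure_mono_null (t := ⋂ m, J ∩ A (n + m)) (fun x hx => ?_) ?_
  · simp only [mem_ofPred_eq, Classical.not_imp, not_exists] at hx
    refine mem_iInter.2 fun m => ⟨hx.1, ?_⟩
    induction m with
    | zero => exact hJA hx.1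
    | succ m ih => exact by_contra fun hn => hx.2 m ⟨ih, hn⟩
  · rw [← measureReal_eq_zero_iff]
    refine le_antisymm (ge_of_tendsto' (x := atTop)
      (f := fun m : ℕ => (1 - a) ^ m * μ.real J) ?_ fun m => ?_) measureReal_nonneg
    · have := (tendsto_pow_atTop_nhds_zero_of_lt_one (r := 1 - a) (by linarith)
        (by linarith)).mul_const (μ.real J)
      rwa [zero_mul] at this
    · rw [← hμ]; exact measureReal_mono (iInter_subset _ m)

/-- The power integral of a function that is geometric along a geometrically decaying sequence of
sets. -/
theorem setLIntegral_rpow_of_geometric [IsFiniteMeasure μ] {A : ℕ → Set X} {a : ℝ} (ha0 : 0 < a)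
    (ha1 : a < 1) (hAm : ∀ n, MeasurableSet (A n)) (hA : Antitone A) {φ : X → ℝ} {c ρ s : ℝ}
    (hc : 0 ≤ c) (hρ : 0 ≤ ρ) (hs : 0 < s) (hsum : ρ ^ s * (1 - a) < 1)
    (hφ : ∀ n, ∀ x ∈ A n \ A (n + 1), φ x = c * ρ ^ n)
    {J : Set X} (hJ : MeasurableSet J) {n : ℕ} (hJA : J ⊆ A n)
    (hμ : ∀ m, μ.real (J ∩ A (n + m)) = (1 - a) ^ m * μ.real J) :
    ∫⁻ x in J, ENNReal.ofReal (φ x) ^ s ∂μ =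
      ENNReal.ofReal (μ.real J * (a * (c * ρ ^ n) ^ s / (1 - ρ ^ s * (1 - a)))) := by
  -- The shells partition `J` up to a null set. Their measures decay by the factor `1 - a` and the
  -- integrand grows by `ρ ^ s`, so the integral is a geometric series of ratio `ρ ^ s * (1 - a)`.
  set E : ℕ → Set X := fun m => J ∩ (A (n + m) \ A (n + m + 1)) with hE
  have hEm : ∀ m, MeasurableSet (E m) := fun m => hJ.inter ((hAm _).diff (hAm _))
  have hEd : Pairwise (Function.onFun Disjoint E) := by
    refine (pairwise_disjoint_on _).2 fun i j hij => disjoint_left.2 fun x hx hx' => hx.2.2 ?_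
    exact hA (by omega) hx'.2.1
  have hEJ : J =ᵐ[μ] ⋃ m, E m := by
    have := ae_exists_mem_sdiff ha0 ha1 hJ hJA hμ
    rw [ae_restrict_iff' hJ] at this
    filter_upwards [this] with x hx
    refine propext ⟨fun h => ?_, fun h => ?_⟩
    · obtain ⟨m, hm⟩ := hx h
      exact mem_iUnion.2 ⟨m, h, hm⟩
    · obtain ⟨m, hm⟩ := mem_iUnion.1 h
      exact hm.1
  have hEμ : ∀ m, μ.real (E m) = a * (1 - a) ^ m * μ.real J := fun m => by
    have he : E m = (J ∩ A (n + m)) \ (J ∩ A (n + m + 1)) := by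
      ext x; simp only [hE, mem_inter_iff, Set.mem_sdiff]; tauto
    rw [he, measureReal_sdiff (inter_subset_inter_right _ (hA (by omega : n + m ≤ n + m + 1)))
      (hJ.inter (hAm _)), hμ, add_assoc, hμ, pow_succ]
    ring
  have hr0 : 0 ≤ ρ ^ s * (1 - a) := mul_nonneg (Real.rpow_nonneg hρ _) (by linarith)
  have hterm : ∀ m, ∫⁻ x in E m, ENNReal.ofReal (φ x) ^ s ∂μ =
      ENNReal.ofReal (μ.real J * (a * (c * ρ ^ n) ^ s) * (ρ ^ s * (1 - a)) ^ m) := fun m => by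
    rw [setLIntegral_congr_fun (hEm m) (g := fun _ => ENNReal.ofReal ((c * ρ ^ (n + m)) ^ s))
      fun x hx => by
        dsimp only
        rw [hφ _ x hx.2, ENNReal.ofReal_rpow_of_nonneg (by positivity) hs.le],
      setLIntegral_const, ← ofReal_measureReal, ← ENNReal.ofReal_mul (by positivity), hEμ]
    congr 1
    have hpow : (ρ ^ m) ^ s = (ρ ^ s) ^ m := by
      rw [← Real.rpow_natCast, ← Real.rpow_natCast, ← Real.rpow_mul hρ, ← Real.rpow_mul hρ,
        mul_comm]
    have hsplit : c * ρ ^ (n + m) = c * ρ ^ n * ρ ^ m := by rw [pow_add, mul_assoc]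
    rw [hsplit, Real.mul_rpow (by positivity) (by positivity), mul_pow, hpow]
    ring
  have hcn : 0 ≤ μ.real J * (a * (c * ρ ^ n) ^ s) := by positivity
  rw [setLIntegral_congr hEJ, lintegral_iUnion hEm hEd]
  simp only [hterm]
  rw [← ENNReal.ofReal_tsum_of_nonneg (fun m => mul_nonneg hcn (pow_nonneg hr0 m))
    ((summable_geometric_of_lt_one hr0 hsum).mul_left _), tsum_mul_left,
    tsum_geometric_of_lt_one hr0 hsum]
  congr 1
  rw [div_eq_mul_inv]; ring

end Nested

/-! ### The equation for the parameters $a$ and $w$ -/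

/-- The parameters of the extremal functions. -/
theorem exists_ratio {p θ z : ℝ} (hp : 1 < p) (hθ0 : 0 < θ) (hθ1 : θ ≤ 1) (hz : 1 ≤ z)
    (h : z = 1 ∨ θ < H p z) :
    ∃ a, 0 < a ∧ a < 1 ∧ ∃ w, z ≤ w ∧ w ^ p - (w - a) ^ p * (1 - a) ^ (1 - p) = a * θ := by
  have hp0 : 0 < p := by linarith
  obtain ⟨a, ha0, ha1, ha⟩ : ∃ a, 0 < a ∧ a < 1 ∧
      a * θ ≤ z ^ p - (z - a) ^ p * (1 - a) ^ (1 - p) := by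
    rcases h with rfl | h
    · refine ⟨1 / 2, by norm_num, by norm_num, ?_⟩
      rw [← Real.rpow_add (by norm_num), add_sub_cancel, Real.one_rpow, Real.rpow_one]
      linarith
    · have hz0 : 0 < z := by linarith
      -- The expression vanishes at `a = 0` and has slope `H p z > θ` there, so it exceeds `a * θ`
      -- for small positive `a`.
      have hd : HasDerivAt (fun a : ℝ => z ^ p - (z - a) ^ p * (1 - a) ^ (1 - p)) (H p z) 0 := by
        have d1 : HasDerivAt (fun a : ℝ => (z - a) ^ p) (-1 * p * (z - 0) ^ (p - 1)) 0 :=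
          ((hasDerivAt_id (0 : ℝ)).const_sub z).rpow_const (.inl (by simpa using hz0.ne'))
        have d2 : HasDerivAt (fun a : ℝ => (1 - a) ^ (1 - p))
            (-1 * (1 - p) * (1 - 0) ^ (1 - p - 1)) 0 :=
          ((hasDerivAt_id (0 : ℝ)).const_sub 1).rpow_const (.inl (by simp))
        refine ((d1.mul d2).const_sub (z ^ p)).congr_deriv ?_
        simp only [sub_zero, Real.one_rpow, H]
        ring
      have ht := hd.tendsto_slope_zero_right
      have he := (ht.eventually (lt_mem_nhds h)).and (Ioo_mem_nhdsGT (zero_lt_one' ℝ))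
      obtain ⟨a, ha, ha01⟩ := he.exists
      refine ⟨a, ha01.1, ha01.2, ?_⟩
      simp only [zero_add, sub_zero, Real.one_rpow, mul_one, sub_self, smul_eq_mul,
        inv_mul_eq_div] at ha
      rw [lt_div_iff₀ ha01.1] at ha
      linarith
  refine ⟨a, ha0, ha1, ?_⟩
  have h1a : 0 < 1 - a := by linarith
  have hpm : (p - 1) / p < 1 := by rw [div_lt_one hp0]; linarith
  have hpm0 : 0 < (p - 1) / p := div_pos (by linarith) hp0
  set t := (1 - a) ^ ((p - 1) / p) with ht
  have ht0 : 0 < t := Real.rpow_pos_of_pos h1a _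
  have ht1 : t < 1 := Real.rpow_lt_one h1a.le (by linarith) hpm0
  have htp : t ^ p * (1 - a) ^ (1 - p) = 1 := by
    rw [ht, ← Real.rpow_mul h1a.le, div_mul_cancel₀ _ hp0.ne', ← Real.rpow_add h1a]
    simp
  have hq : 0 < (1 - a) ^ (1 - p) := Real.rpow_pos_of_pos h1a _
  -- The solution of $w - a = wt$, at which the left side of the equation vanishes. At `z` it is at
  -- least `a * θ`, so the intermediate value theorem gives a root between.
  set w₁ := a / (1 - t) with hw₁
  have hw₁0 : 0 < w₁ := div_pos ha0 (by linarith)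
  have hw₁t : w₁ - a = w₁ * t := by
    have : 1 - t ≠ 0 := by linarith
    rw [hw₁]; field_simp; ring
  have hzero : w₁ ^ p - (w₁ - a) ^ p * (1 - a) ^ (1 - p) = 0 := by
    rw [hw₁t, Real.mul_rpow hw₁0.le ht0.le, mul_assoc, htp]; ring
  have hzw : z ≤ w₁ := by
    by_contra! hlt
    have hzt : z * t ≤ z - a := by
      rw [hw₁, div_lt_iff₀ (by linarith)] at hlt
      linarith
    have h3 := Real.rpow_le_rpow (by positivity) hzt hp0.le
    rw [Real.mul_rpow (by linarith) ht0.le] at h3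
    have h4 := mul_le_mul_of_nonneg_right h3 hq.le
    rw [mul_assoc, htp, mul_one] at h4
    have := mul_pos ha0 hθ0
    linarith
  have hcont : ContinuousOn (fun w : ℝ => w ^ p - (w - a) ^ p * (1 - a) ^ (1 - p))
      (Icc z w₁) := by
    refine Continuous.continuousOn ?_
    exact (Real.continuous_rpow_const hp0.le).sub
      (((Real.continuous_rpow_const hp0.le).comp (continuous_sub_right a)).mul continuous_const)
  obtain ⟨w, hw, he⟩ := intermediate_value_Icc' hzw hcont
    (show a * θ ∈ Icc _ _ from ⟨by simp only [hzero]; positivity, ha⟩)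
  exact ⟨w, hw.1, he⟩

/-! ### The lower bound -/

section LowerBound

variable {X : Type*} [MeasurableSpace X] {μ : Measure X} {T : Set (Set X)}

/-- A function with prescribed mean and power mean on a set `K` of measure `k`, constant off `K`,
whose maximal function is at least `w` times the function on `K`. -/
theorem IsTree.ofReal_le_bellman_of_ratio [IsProbabilityMeasure μ] (hT : IsTree μ T)
    {p f F k A B w a : ℝ} (hp : 1 < p) (hk0 : 0 < k) (hk1 : k ≤ 1) (hB0 : 0 < B) (hBf : B ≤ f)
    (hBk : k = 1 → B = f) (hA0 : 0 < A) (hA : A = Afun p f F k B) (ha0 : 0 < a) (ha1 : a < 1)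
    (hw : 1 ≤ w)
    (heq : w ^ p - (w - a) ^ p * (1 - a) ^ (1 - p) = a * (B ^ p / (k ^ (p - 1) * A))) :
    ENNReal.ofReal (A * w ^ p) ≤ bellman μ T p f F k := by
  have hp0 : 0 < p := by linarith
  have hw0 : 0 < w := by linarith
  have h1a : 0 < 1 - a := by linarith
  obtain ⟨S, hST, hanti, hSμ, hSJ⟩ := hT.exists_nested_families (μ := μ)
    (q := ENNReal.ofReal (1 - a)) (c := ENNReal.ofReal k)
    (ENNReal.ofReal_le_one.2 (by linarith)) (by rw [measure_univ]; exact ENNReal.ofReal_le_one.2 hk1)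
  obtain ⟨C, hC⟩ := hT.exists_isChildMap
  set E : ℕ → Set X := fun n => ⋃₀ S n with hE
  have hEm : ∀ n, MeasurableSet (E n) := fun n =>
    .sUnion (hC.countable_tree.mono (hST n)) fun I hI => hT.measurableSet I (hST n hI)
  have hEanti : Antitone E := antitone_nat_of_succ_le hanti
  have hEk : μ.real (E 0) = k := by
    rw [measureReal_def, hSμ 0, pow_zero, one_mul, ENNReal.toReal_ofReal hk0.le]
  have hdec : ∀ n, ∀ J ∈ S n, ∀ m, μ.real (J ∩ E (n + m)) = (1 - a) ^ m * μ.real J := by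
    intro n J hJ m
    rw [measureReal_def, hSJ n J hJ m, ENNReal.toReal_mul, ENNReal.toReal_pow,
      ENNReal.toReal_ofReal h1a.le, measureReal_def]
  have hdec0 : ∀ m, μ.real (E 0 ∩ E (0 + m)) = (1 - a) ^ m * μ.real (E 0) := by
    intro m
    rw [inter_eq_self_of_subset_right (hEanti (Nat.zero_le _)), measureReal_def, zero_add, hSμ m,
      ENNReal.toReal_mul, ENNReal.toReal_pow, ENNReal.toReal_ofReal h1a.le, hEk,
      ENNReal.toReal_ofReal hk0.le]
  -- `ρ` makes the averages over elements of `S n` equal to $w c\rho^n$, `c` gives $\varphi$ the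
  -- integral `B` on `E 0`, and `e` gives it the integral `f - B` off `E 0`. For `k = 1` the default
  -- value `e = 0` is harmless, since the complement is null. The equation `heq` then says that the
  -- `p`-th moment on `E 0` is `A`.
  set ρ := (1 - a / w) / (1 - a) with hρ
  set c := B / (k * w) with hc
  set e := (f - B) / (1 - k) with he
  have haw : a / w < 1 := by rw [div_lt_one hw0]; linarith
  have hρ0 : 0 < ρ := div_pos (by linarith) h1a
  have hc0 : 0 < c := by positivity
  have he0 : 0 ≤ e := div_nonneg (by linarith) (by linarith)
  have hρ1 : ρ ^ (1 : ℝ) * (1 - a) = 1 - a / w := by rw [Real.rpow_one, hρ]; field_simp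
  have hρp : 1 - ρ ^ p * (1 - a) = a * (B ^ p / (k ^ (p - 1) * A)) / w ^ p := by
    have hwp := (Real.rpow_pos_of_pos hw0 p).ne'
    have h1 : 1 - a / w = (w - a) / w := by field_simp
    have hap := (Real.rpow_pos_of_pos h1a p).ne'
    rw [← heq, hρ, h1, Real.div_rpow (div_nonneg (by linarith) hw0.le) h1a.le,
      Real.div_rpow (by linarith) hw0.le, Real.rpow_sub h1a, Real.rpow_one]
    field_simp
  have hkp : 0 < k ^ (p - 1) := Real.rpow_pos_of_pos hk0 _
  have hBp : 0 < B ^ p := Real.rpow_pos_of_pos hB0 _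
  have hwp : 0 < w ^ p := Real.rpow_pos_of_pos hw0 _
  have hsum1 : ρ ^ (1 : ℝ) * (1 - a) < 1 := by rw [hρ1]; linarith [div_pos ha0 hw0]
  have hsump : ρ ^ p * (1 - a) < 1 := by
    have : 0 < 1 - ρ ^ p * (1 - a) := by rw [hρp]; positivity
    linarith
  -- Piece `0` is the complement of `E 0` and piece `n + 1` is the shell `E n \ E (n + 1)`. Nothing
  -- is prescribed on the intersection of all `E n`; the absolute value taken afterwards secures
  -- nonnegativity there.
  obtain ⟨ψ, hψm, hψ⟩ := exists_measurable_piecewise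
    (fun n : ℕ => Nat.casesOn (motive := fun _ => Set X) n (E 0)ᶜ fun n => E n \ E (n + 1))
    (fun n => by cases n; exacts [(hEm 0).compl, (hEm _).diff (hEm _)])
    (fun n _ => Nat.casesOn (motive := fun _ => ℝ) n e fun n => c * ρ ^ n) (fun n => measurable_const) (by
      refine (pairwise_disjoint_on _).2 (fun i j hij => ?_) |>.mono fun i j hd x hx =>
        absurd hx.2 (disjoint_left.1 hd hx.1)
      refine disjoint_left.2 fun x hx hx' => ?_
      obtain ⟨j, rfl⟩ : ∃ j', j = j' + 1 := ⟨j - 1, by omega⟩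
      cases i with
      | zero => exact hx (hEanti (Nat.zero_le _) hx'.1)
      | succ i => exact hx.2 (hEanti (by omega) hx'.1))
  have hψ0 : ∀ x ∈ (E 0)ᶜ, ψ x = e := fun x hx => hψ 0 hx
  have hψn : ∀ n, ∀ x ∈ E n \ E (n + 1), ψ x = c * ρ ^ n := fun n x hx => hψ (n + 1) hx
  set φ : X → ℝ := fun x => |ψ x| with hφ
  have hφm : Measurable φ := hψm.abs
  have hφ0 : ∀ x, 0 ≤ φ x := fun x => abs_nonneg _
  have hφe : ∀ x ∈ (E 0)ᶜ, φ x = e := fun x hx => by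
    rw [hφ]; dsimp only; rw [hψ0 x hx, abs_of_nonneg he0]
  have hφn : ∀ n, ∀ x ∈ E n \ E (n + 1), φ x = c * ρ ^ n := fun n x hx => by
    rw [hφ]; dsimp only; rw [hψn n x hx, abs_of_nonneg (by positivity)]
  have hoff : ∀ s : ℝ, 0 < s →
      ∫⁻ x in (E 0)ᶜ, ENNReal.ofReal (φ x) ^ s ∂μ = ENNReal.ofReal (e ^ s * (1 - k)) := by
    intro s hs
    rw [setLIntegral_congr_fun (hEm 0).compl (g := fun _ => ENNReal.ofReal (e ^ s)) fun x hx => by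
        dsimp only
        rw [hφe x hx, ENNReal.ofReal_rpow_of_nonneg he0 hs.le],
      setLIntegral_const, ← ofReal_measureReal, probReal_compl_eq_one_sub (hEm 0), hEk,
      ← ENNReal.ofReal_mul (Real.rpow_nonneg he0 _)]
  have hek : e * (1 - k) = f - B := by
    rcases hk1.eq_or_lt with h | h
    · rw [h, sub_self, mul_zero, hBk h, sub_self]
    · rw [he, div_mul_cancel₀ _ (by linarith)]
  have hekp : e ^ p * (1 - k) = (f - B) ^ p / (1 - k) ^ (p - 1) := by
    rcases hk1.eq_or_lt with h | h
    · rw [h, sub_self, mul_zero, Real.zero_rpow (by linarith), div_zero]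
    · have h1k : 0 < 1 - k := by linarith
      have := (Real.rpow_pos_of_pos h1k p).ne'
      rw [he, Real.div_rpow (by linarith) h1k.le, Real.rpow_sub_one h1k.ne']
      field_simp
  have hon1 : ∫⁻ x in E 0, ENNReal.ofReal (φ x) ^ (1 : ℝ) ∂μ = ENNReal.ofReal B := by
    rw [setLIntegral_rpow_of_geometric ha0 ha1 hEm hEanti hc0.le hρ0.le one_pos hsum1 hφn (hEm 0)
      Subset.rfl hdec0, hρ1, hEk, Real.rpow_one, pow_zero, hc,
      sub_sub_cancel]
    congr 1
    field_simp
  have honp : ∫⁻ x in E 0, ENNReal.ofReal (φ x) ^ p ∂μ = ENNReal.ofReal A := by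
    rw [setLIntegral_rpow_of_geometric ha0 ha1 hEm hEanti hc0.le hρ0.le hp0 hsump hφn (hEm 0)
      Subset.rfl hdec0, hρp, hEk, pow_zero, mul_one, hc, Real.div_rpow hB0.le (by positivity),
      Real.mul_rpow hk0.le hw0.le, Real.rpow_sub_one hk0.ne']
    have := (Real.rpow_pos_of_pos hk0 p).ne'
    congr 1
    field_simp
  have htot1 : ∫⁻ x, ENNReal.ofReal (φ x) ∂μ = ENNReal.ofReal f := by
    have := hoff 1 one_pos
    simp only [ENNReal.rpow_one, Real.rpow_one] at hon1 this
    rw [← lintegral_add_compl _ (hEm 0), hon1, this, hek, ← ENNReal.ofReal_add hB0.le (by linarith)]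
    congr 1; ring
  have htotp : ∫⁻ x, ENNReal.ofReal (φ x) ^ p ∂μ = ENNReal.ofReal F := by
    rw [← lintegral_add_compl _ (hEm 0), honp, hoff p hp0, hekp,
      ← ENNReal.ofReal_add hA0.le
        (hekp ▸ mul_nonneg (Real.rpow_nonneg he0 _) (sub_nonneg.2 hk1)), hA]
    congr 1; unfold Afun; ring
  have hF0 : 0 ≤ F := by
    have h3 : 0 ≤ (f - B) ^ p / (1 - k) ^ (p - 1) := by
      rw [← hekp]; exact mul_nonneg (Real.rpow_nonneg he0 _) (by linarith)
    have h4 : 0 < F - (f - B) ^ p / (1 - k) ^ (p - 1) := by rw [hA] at hA0; exact hA0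
    linarith
  have hM : ∀ᵐ x ∂μ.restrict (E 0),
      ENNReal.ofReal (w * φ x) ≤ max (maximal μ T φ x) (ENNReal.ofReal f) := by
    filter_upwards [ae_exists_mem_sdiff ha0 ha1 (hEm 0) Subset.rfl hdec0] with x hx
    obtain ⟨n, hx⟩ := hx
    rw [zero_add] at hx
    obtain ⟨J, hJ, hxJ⟩ := hx.1
    have hJT := hST n hJ
    refine le_max_of_le_left (le_trans ?_ (le_maximal hJT hxJ))
    have hg := setLIntegral_rpow_of_geometric ha0 ha1 hEm hEanti hc0.le hρ0.le one_pos hsum1 hφn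
      (hT.measurableSet J hJT) (subset_sUnion_of_mem hJ) (hdec n J hJ)
    simp only [ENNReal.rpow_one] at hg
    rw [ENNReal.le_div_iff_mul_le (.inl (hT.measure_pos J hJT).ne') (.inl (measure_ne_top _ _))]
    simp only [Real.enorm_of_nonneg (hφ0 _)]
    rw [hg, hφn n x hx, ← ofReal_measureReal, ← ENNReal.ofReal_mul (by positivity), hρ1,
      Real.rpow_one, sub_sub_cancel]
    refine ENNReal.ofReal_le_ofReal (le_of_eq ?_)
    field_simp
  refine le_trans ?_ (le_sSup (a := ∫⁻ x in E 0,
    max (maximal μ T φ x) (ENNReal.ofReal f) ^ p ∂μ) ⟨φ, E 0, hφ0, ?_, ?_, ?_, hEm 0, ?_, rfl⟩)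
  · calc ENNReal.ofReal (A * w ^ p) = ENNReal.ofReal (w ^ p) *
          ∫⁻ x in E 0, ENNReal.ofReal (φ x) ^ p ∂μ := by
          rw [honp, ← ENNReal.ofReal_mul hwp.le, mul_comm]
      _ = ∫⁻ x in E 0, ENNReal.ofReal (w * φ x) ^ p ∂μ := by
          rw [← lintegral_const_mul' _ _ ENNReal.ofReal_ne_top]
          refine lintegral_congr fun x => ?_
          rw [ENNReal.ofReal_mul hw0.le, ENNReal.mul_rpow_of_nonneg _ _ hp0.le,
            ENNReal.ofReal_rpow_of_nonneg hw0.le hp0.le]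
      _ ≤ _ := lintegral_mono_ae (hM.mono fun x hx => ENNReal.rpow_le_rpow hx hp0.le)
  · refine ⟨hφm.aestronglyMeasurable, ?_⟩
    rw [eLpNorm_lt_top_iff_lintegral_rpow_enorm_lt_top (by simpa using hp0) ENNReal.ofReal_ne_top,
      ENNReal.toReal_ofReal hp0.le]
    simp only [Real.enorm_of_nonneg (hφ0 _)]
    rw [htotp]
    exact ENNReal.ofReal_lt_top
  · rw [integral_eq_lintegral_of_nonneg_ae (Eventually.of_forall hφ0) hφm.aestronglyMeasurable,
      htot1, ENNReal.toReal_ofReal (by linarith)]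
  · rw [integral_eq_lintegral_of_nonneg_ae
      (Eventually.of_forall fun x => Real.rpow_nonneg (hφ0 x) _)
      (hφm.pow_const p).aestronglyMeasurable]
    simp only [← ENNReal.ofReal_rpow_of_nonneg (hφ0 _) hp0.le]
    rw [htotp, ENNReal.toReal_ofReal hF0]
  · rw [hSμ 0, pow_zero, one_mul]

theorem IsTree.ofReal_mul_rpow_le_bellman [IsProbabilityMeasure μ] (hT : IsTree μ T)
    {p f F k B z : ℝ} (hp : 1 < p) (hk0 : 0 < k) (hk1 : k ≤ 1) (hB0 : 0 < B) (hBf : B ≤ f)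
    (hBk : k = 1 → B = f) (hBA : B ^ p / k ^ (p - 1) ≤ Afun p f F k B) (hz : 1 ≤ z)
    (h : z = 1 ∨ B ^ p / (k ^ (p - 1) * Afun p f F k B) < H p z) :
    ENNReal.ofReal (Afun p f F k B * z ^ p) ≤ bellman μ T p f F k := by
  have hpos : 0 < B ^ p / k ^ (p - 1) :=
    div_pos (Real.rpow_pos_of_pos hB0 _) (Real.rpow_pos_of_pos hk0 _)
  have hA0 : 0 < Afun p f F k B := hpos.trans_le hBA
  obtain ⟨a, ha0, ha1, w, hzw, hw⟩ := exists_ratio hp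
    (θ := B ^ p / (k ^ (p - 1) * Afun p f F k B)) (by rw [← div_div]; exact div_pos hpos hA0)
    (by rw [← div_div]; exact (div_le_one hA0).2 hBA) hz h
  refine le_trans (ENNReal.ofReal_le_ofReal (mul_le_mul_of_nonneg_left ?_ hA0.le))
    (hT.ofReal_le_bellman_of_ratio hp hk0 hk1 hB0 hBf hBk hA0 rfl ha0 ha1 (hz.trans hzw) hw)
  exact Real.rpow_le_rpow (by linarith) hzw (by linarith)

/-- An upper bound for all `z < o` close to `o` passes to the limit. -/
theorem ofReal_mul_rpow_le_of_forall_lt {A p o : ℝ} {M : ℝ≥0∞} (hp : 0 < p) (ho : 1 < o)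
    (h : ∀ z, 1 ≤ z → z < o → ENNReal.ofReal (A * z ^ p) ≤ M) :
    ENNReal.ofReal (A * o ^ p) ≤ M := by
  have ht : Tendsto (fun z : ℝ => ENNReal.ofReal (A * z ^ p)) (𝓝[<] o)
      (𝓝 (ENNReal.ofReal (A * o ^ p))) :=
    ((ENNReal.continuous_ofReal.comp
      (continuous_const.mul (Real.continuous_rpow_const hp.le))).tendsto o).mono_left
      nhdsWithin_le_nhds
  refine le_of_tendsto ht ?_
  filter_upwards [Ioo_mem_nhdsLT ho] with z hz using h z hz.1.le hz.2

/-- The lower bound: every value of `Rfun` at an admissible point is at most the Bellman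
function. -/
theorem IsTree.ofReal_Rfun_le_bellman [IsProbabilityMeasure μ] (hT : IsTree μ T)
    {p f F k B : ℝ} (hp : 1 < p) (hf : 0 < f) (hk0 : 0 < k) (hk1 : k ≤ 1)
    (hB : B ∈ admissible p f F k) :
    ENNReal.ofReal (Rfun p f F k B) ≤ bellman μ T p f F k := by
  obtain ⟨⟨hB0, hBf⟩, hF, hBk⟩ := hB
  have hp0 : 0 < p := by linarith
  have hkp : 0 < k ^ (p - 1) := Real.rpow_pos_of_pos hk0 _
  have hBA : B ^ p / k ^ (p - 1) ≤ Afun p f F k B := by unfold hfun at hF; unfold Afun; linarith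
  unfold Rfun
  -- At `B = 0` the construction would have no mass on `E 0`. A small `b > 0` serves instead: `Afun`
  -- does not decrease when passing from `0` to `b`, and $\theta$ stays below `H p z` for each fixed
  -- $z < \omega_p(0)$.
  rcases hB0.eq_or_lt with rfl | hBpos
  · have hk : k < 1 := hk1.lt_of_ne fun h => hf.ne (hBk h)
    rw [Real.zero_rpow hp0.ne', zero_div]
    rw [Real.zero_rpow hp0.ne', zero_div] at hBA
    rcases hBA.eq_or_lt with hA | hA
    · rw [← hA, zero_mul, ENNReal.ofReal_zero]; exact zero_le
    have hmem : (0 : ℝ) ∈ Icc (0 : ℝ) 1 := ⟨le_rfl, zero_le_one⟩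
    have ho : 1 < omega p 0 := (omega_mem hp hmem).1.lt_of_ne fun h => by
      have := H_omega hp hmem
      rw [← h] at this
      simp [H] at this
    refine ofReal_mul_rpow_le_of_forall_lt hp0 ho fun z hz hzo => ?_
    have hH := lt_H_of_lt_omega hp hmem hz hzo
    have hH1 : H p z ≤ 1 := by
      have := (strictAntiOn_H hp).antitoneOn (mem_Ici.2 (le_refl (1 : ℝ))) hz hz
      simpa [H] using this
    have ht : Tendsto (fun b : ℝ => b ^ p / k ^ (p - 1)) (𝓝[>] 0) (𝓝 0) := by
      have := ((Real.continuous_rpow_const hp0.le).div_const (k ^ (p - 1))).tendsto 0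
      rw [Real.zero_rpow hp0.ne', zero_div] at this
      exact this.mono_left nhdsWithin_le_nhds
    obtain ⟨b, hb, hb0, hbf⟩ := ((ht.eventually (gt_mem_nhds (mul_pos hH hA))).and
      (Ioo_mem_nhdsGT hf)).exists
    have hAb : Afun p f F k 0 ≤ Afun p f F k b := by
      unfold Afun
      have : 0 ≤ (1 - k) ^ (p - 1) := Real.rpow_nonneg (by linarith) _
      have h3 : (f - b) ^ p ≤ (f - 0) ^ p := Real.rpow_le_rpow (by linarith) (by linarith) hp0.le
      exact sub_le_sub_left (div_le_div_of_nonneg_right h3 this) _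
    have hlt : b ^ p / k ^ (p - 1) < H p z * Afun p f F k b :=
      hb.trans_le (mul_le_mul_of_nonneg_left hAb hH.le)
    have hAb0 : 0 < Afun p f F k b := hA.trans_le hAb
    refine le_trans (ENNReal.ofReal_le_ofReal (mul_le_mul_of_nonneg_right hAb
      (Real.rpow_nonneg (by linarith) _))) (hT.ofReal_mul_rpow_le_bellman hp hk0 hk1 hb0 hbf.le
        (fun h => absurd h hk.ne) (hlt.le.trans (mul_le_of_le_one_left hAb0.le hH1)) hz (.inr ?_))
    rwa [← div_div, div_lt_iff₀ hAb0]
  · have hpos : 0 < B ^ p / k ^ (p - 1) := div_pos (Real.rpow_pos_of_pos hBpos _) hkp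
    have hA0 : 0 < Afun p f F k B := hpos.trans_le hBA
    have hθ : B ^ p / (k ^ (p - 1) * Afun p f F k B) ∈ Icc (0 : ℝ) 1 := by
      rw [← div_div]; exact ⟨(div_pos hpos hA0).le, (div_le_one hA0).2 hBA⟩
    -- If $\omega_p(\theta) = 1$ there is no `z` in $[1, \omega_p(\theta))$ to approach it with, so
    -- `z = 1` is used directly.
    rcases (omega_mem hp hθ).1.eq_or_lt with ho | ho
    · rw [← ho]
      exact hT.ofReal_mul_rpow_le_bellman hp hk0 hk1 hBpos hBf hBk hBA le_rfl (.inl rfl)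
    · exact ofReal_mul_rpow_le_of_forall_lt hp0 ho fun z hz hzo =>
        hT.ofReal_mul_rpow_le_bellman hp hk0 hk1 hBpos hBf hBk hBA hz
          (.inr (lt_H_of_lt_omega hp hθ hz hzo))

end LowerBound

/-! ### Attainable values and passage to measurable representatives -/

section Main

variable {X : Type*} [MeasurableSpace X] {μ : Measure X} {T : Set (Set X)}

theorem maximal_congr {φ ψ : X → ℝ} (h : φ =ᵐ[μ] ψ) : maximal μ T φ = maximal μ T ψ := by
  ext x
  unfold maximal
  have : ∀ I : Set X, ∫⁻ y in I, ‖φ y‖ₑ ∂μ = ∫⁻ y in I, ‖ψ y‖ₑ ∂μ := fun I =>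
    lintegral_congr_ae (ae_restrict_of_ae (h.fun_comp fun y => ‖y‖ₑ))
  simp only [this]

/-- The point $B = kf$ belongs to equal means on a set of measure $k$ and its complement, so
$h_k(kf) = f^p$. It makes the admissible set nonempty. -/
theorem mul_mem_admissible {p f F k : ℝ} (hp : 1 < p) (hf : 0 < f) (hfF : f ^ p ≤ F) (hk0 : 0 < k)
    (hk1 : k ≤ 1) : k * f ∈ admissible p f F k := by
  refine ⟨⟨by positivity, mul_le_of_le_one_left hf.le hk1⟩, le_trans (le_of_eq ?_) hfF,
    fun h => by rw [h, one_mul]⟩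
  have h1 : ∀ t : ℝ, 0 ≤ t → (t * f) ^ p / t ^ (p - 1) = t * f ^ p := fun t ht => by
    rcases ht.eq_or_lt with rfl | ht
    · rw [zero_mul, Real.zero_rpow (by linarith), zero_div, zero_mul]
    · have := (Real.rpow_pos_of_pos ht p).ne'
      rw [Real.mul_rpow ht.le hf.le, Real.rpow_sub_one ht.ne']
      field_simp
  rw [hfun, show f - k * f = (1 - k) * f by ring, h1 _ (by linarith), h1 _ hk0.le]
  ring

/-- The upper end is Doob's constant, coming from $\omega_p \le p/(p-1)$ and $A_k(B) \le F$; it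
yields finiteness of the Bellman function. -/
theorem Rfun_mem_Icc {p f F k B : ℝ} (hp : 1 < p) (hk0 : 0 < k) (hk1 : k ≤ 1)
    (hB : B ∈ admissible p f F k) : Rfun p f F k B ∈ Icc 0 (F * (p / (p - 1)) ^ p) := by
  obtain ⟨⟨hB0, hBf⟩, hF, -⟩ := hB
  have hpos : 0 ≤ B ^ p / k ^ (p - 1) :=
    div_nonneg (Real.rpow_nonneg hB0 _) (Real.rpow_nonneg hk0.le _)
  have hBA : B ^ p / k ^ (p - 1) ≤ Afun p f F k B := by unfold hfun at hF; unfold Afun; linarith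
  have hAF : Afun p f F k B ≤ F := sub_le_self _
    (div_nonneg (Real.rpow_nonneg (by linarith) _) (Real.rpow_nonneg (by linarith) _))
  have hA0 : 0 ≤ Afun p f F k B := hpos.trans hBA
  have ho := omega_mem hp (θ := B ^ p / (k ^ (p - 1) * Afun p f F k B))
    (by rw [← div_div]; exact ⟨div_nonneg hpos hA0, div_le_one_of_le₀ hBA hA0⟩)
  have ho0 : 0 ≤ omega p (B ^ p / (k ^ (p - 1) * Afun p f F k B)) := zero_le_one.trans ho.1
  exact ⟨mul_nonneg hA0 (Real.rpow_nonneg ho0 _), mul_le_mul hAF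
    (Real.rpow_le_rpow ho0 ho.2 (by linarith)) (Real.rpow_nonneg ho0 _) (hA0.trans hAF)⟩

/-- Every competitor in the definition of the Bellman function is dominated by a value of
`Rfun`. -/
theorem IsTree.exists_admissible_of_memLp [IsProbabilityMeasure μ] (hT : IsTree μ T)
    {p f F k : ℝ} (hp : 1 < p) (hf : 0 < f) (hk0 : 0 < k) (hk1 : k ≤ 1) {φ : X → ℝ}
    (h0 : ∀ x, 0 ≤ φ x) (hφ : MemLp φ (ENNReal.ofReal p) μ) (hφf : ∫ x, φ x ∂μ = f)
    (hφF : ∫ x, φ x ^ p ∂μ = F) {K : Set X} (hKk : μ K = ENNReal.ofReal k) :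
    ∃ B ∈ admissible p f F k,
      ∫⁻ x in K, max (maximal μ T φ x) (ENNReal.ofReal f) ^ p ∂μ ≤
        ENNReal.ofReal (Rfun p f F k B) := by
  have hp0 : 0 < p := by linarith
  set ψ : X → ℝ := fun x => |hφ.1.mk φ x| with hψ
  have hae : φ =ᵐ[μ] ψ := hφ.1.ae_eq_mk.mono fun x hx => by
    rw [hψ]; dsimp only; rw [← hx, abs_of_nonneg (h0 x)]
  have hψm : Measurable ψ := hφ.1.stronglyMeasurable_mk.measurable.abs
  have h1 : Integrable ψ μ := (hφ.integrable (ENNReal.one_le_ofReal.2 hp.le)).congr hae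
  have hpow : (fun x => φ x ^ p) =ᵐ[μ] fun x => ψ x ^ p := hae.fun_comp fun y => y ^ p
  have h2 : Integrable (fun x => ψ x ^ p) μ := by
    have := hφ.integrable_norm_rpow (by simpa using hp0) ENNReal.ofReal_ne_top
    rw [ENNReal.toReal_ofReal hp0.le] at this
    refine this.congr (hae.mono fun x hx => ?_)
    dsimp only
    rw [Real.norm_of_nonneg (h0 x), hx]
  rw [maximal_congr hae]
  exact hT.exists_lintegral_le hψm (fun x => abs_nonneg _) h1 hp h2 hf hk0 hk1
    ((integral_congr_ae hae).symm.trans hφf) ((integral_congr_ae hpow).symm.trans hφF) hKk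

end Main

end TreeBellman

theorem theorem1p1 {X : Type*} [MeasurableSpace X] (μ : Measure X) [IsProbabilityMeasure μ]
    (hμ : TreeBellman.Nonatomic μ) (T : Set (Set X)) (hT : TreeBellman.IsTree μ T)
    (p : ℝ) (hp : 1 < p) (f F k : ℝ) (hf : 0 < f) (hfF : f ^ p ≤ F) (hk0 : 0 < k) (hk1 : k ≤ 1) :
    TreeBellman.bellman μ T p f F k ≠ ∞ ∧
    IsLUB (TreeBellman.Rfun p f F k '' TreeBellman.admissible p f F k)
      (TreeBellman.bellman μ T p f F k).toReal := by
  have hfin : TreeBellman.bellman μ T p f F k ≠ ∞ := by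
    refine ne_top_of_le_ne_top (ENNReal.ofReal_ne_top (r := F * (p / (p - 1)) ^ p)) (sSup_le ?_)
    rintro v ⟨φ, K, h0, hφ, hφf, hφF, -, hKk, rfl⟩
    obtain ⟨B, hB, hle⟩ := hT.exists_admissible_of_memLp hp hf hk0 hk1 h0 hφ hφf hφF hKk
    exact hle.trans (ENNReal.ofReal_le_ofReal (TreeBellman.Rfun_mem_Icc hp hk0 hk1 hB).2)
  refine ⟨hfin, ?_, fun M hM => ?_⟩
  · rintro _ ⟨B, hB, rfl⟩
    exact (ENNReal.ofReal_le_iff_le_toReal hfin).1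
      (hT.ofReal_Rfun_le_bellman hp hf hk0 hk1 hB)
  · have hmem := TreeBellman.mul_mem_admissible hp hf hfF hk0 hk1
    -- Nonnegativity of `M` is needed because `ENNReal.ofReal` truncates negative numbers.
    have hM0 : 0 ≤ M := (TreeBellman.Rfun_mem_Icc hp hk0 hk1 hmem).1.trans
      (hM (mem_image_of_mem _ hmem))
    refine ENNReal.toReal_le_of_le_ofReal hM0 (sSup_le ?_)
    rintro v ⟨φ, K, h0, hφ, hφf, hφF, -, hKk, rfl⟩
    obtain ⟨B, hB, hle⟩ := hT.exists_admissible_of_memLp hp hf hk0 hk1 h0 hφ hφf hφF hKk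
    exact hle.trans (ENNReal.ofReal_le_ofReal (hM (mem_image_of_mem _ hB)))
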